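/- Write $[m]=\{1,2,\dots,m\}$, with $[0]=\emptyset$. A rooted tree on a finite set $X$ is a connected acyclic graph with vertex set $X$ and a distinguished vertex, its root. The parent of a vertex $v$ other than the root is the vertex preceding $v$ on the path from the root to $v$, and $v$ is then a child of it; a leaf is a vertex without children. A rooted tree is decreasing if every nonleaf is greater than its children. The maximal decreasing subtree of a rooted tree $T$ is the largest decreasing subtree of $T$ with the same root as $T$. A rooted tree is minimally rooted if its root has no smaller children. An ordered forest on $X$ is a tuple of rooted trees whose vertex sets form a partition of $X$. An ordered forest $(T_0,T_1,\dots,T_\ell)$, $\ell\ge 0$, is $k$-good if - in the case $\ell=0$: either no vertex of $T_0$ lies in $[k]$, or $T_0$ has only one vertex $v$ and $v\in[k]$; - in the case $\ell\ge1$: $T_1,\dots,T_\ell$ are minimally rooted, the number of vertices of $T_0,\dots,T_i$ contained in $[k]$ is at least $i+1$ for $i=0,1,\dots,\ell-1$, and it is equal to $\ell$ for $i=\ell$. **Theorem.** Let $n$ and $k$ be integers with $0\le k\le n$. The following sets are finite and have the same cardinality (any two of them are in bijection): 1. the set $\mathcal T_{n,k}$ of rooted trees on $[n+1]$ whose maximal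 decreasing subtree has $k+1$ vertices; 2. the set $\mathcal A_{n,k}$ of cycles $[T_0,\dots,T_k]$ (sequences up to cyclic rotation) of $k+1$ minimally rooted trees whose vertex sets form a partition of $[n+1]$; 3. the set $\mathcal B_{n,k}$ of ordered forests on $[n]$ that have at least $k$ trees and whose last $k$ trees are minimally rooted; 4. the set $\mathcal C_{n,k}$ of finite sequences of $k$-good ordered forests whose vertex sets form a partition of $[n]$; 5. the set $\mathcal F_{n,k}$ of rooted trees on $[n+1]$ in which $n+1$ is a leaf and $1,2,\dots,k$ are nonleaves. In particular, $|\mathcal T_{n,k}|$ equals the number of functions $f:[n]\to[n]$ with $[k]\subseteq f([n])$. If $k>n\ge 0$, the same holds with $\mathcal C_{n,k}$ omitted from the list. -/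

import Mathlib

namespace LabelledTrees

/-- A rooted tree on a finite set `verts` of natural numbers. The graph lives on `ℕ`, but all its
edges join members of `verts`, and it is connected and acyclic as a graph with vertex set `verts`. -/
@[ext]
structure RTree where
  verts : Finset ℕ
  graph : SimpleGraph ℕ
  root : ℕ
  root_mem : root ∈ verts
  mem_of_adj : ∀ u v, graph.Adj u v → u ∈ verts ∧ v ∈ verts
  isTree : (graph.induce (verts : Set ℕ)).IsTree

namespace RTree

/-- `v` is a child of `u`: `v` is not the root, and `u` is the last vertex before `v` on the
path from the root to `v`. -/
def IsChild (T : RTree) (u v : ℕ) : Prop :=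
  v ≠ T.root ∧ ∃ p : T.graph.Walk T.root v, p.IsPath ∧ p.penultimate = u

/-- A vertex without children. -/
def IsLeaf (T : RTree) (v : ℕ) : Prop :=
  v ∈ T.verts ∧ ∀ w, ¬ T.IsChild v w

/-- A vertex with at least one child. -/
def IsNonleaf (T : RTree) (v : ℕ) : Prop :=
  v ∈ T.verts ∧ ∃ w, T.IsChild v w

/-- Every nonleaf is greater than its children. -/
def IsDecreasing (T : RTree) : Prop :=
  ∀ u v, T.IsChild u v → v < u

/-- The root has no smaller children. -/
def IsMinimallyRooted (T : RTree) : Prop :=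
  ∀ v, T.IsChild T.root v → ¬ v < T.root

/-- `S` is a subtree of `T`. -/
def IsSubtree (S T : RTree) : Prop :=
  S.verts ⊆ T.verts ∧ S.graph ≤ T.graph

/-- `S` is a decreasing subtree of `T` with the same root. -/
def IsDecreasingSubtree (S T : RTree) : Prop :=
  S.IsSubtree T ∧ S.root = T.root ∧ S.IsDecreasing

/-- `M` is the maximal decreasing subtree of `T`: the largest one among the decreasing subtrees
with the same root. -/
def IsMaximalDecreasingSubtree (M T : RTree) : Prop :=
  M.IsDecreasingSubtree T ∧ ∀ S : RTree, S.IsDecreasingSubtree T → S.IsSubtree M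

end RTree

/-- The set of all vertices of the trees in a list. -/
def vertsOf (F : List RTree) : Finset ℕ :=
  F.foldr (fun T s => T.verts ∪ s) ∅

/-- An ordered forest (on the set `vertsOf F`): the vertex sets of the trees are disjoint. They are
nonempty because each contains a root. -/
def IsOrderedForest (F : List RTree) : Prop :=
  F.Pairwise fun S T => Disjoint S.verts T.verts

/-- An ordered forest on the set `X`. -/
def IsOrderedForestOn (F : List RTree) (X : Finset ℕ) : Prop :=
  IsOrderedForest F ∧ vertsOf F = X

/-- The number of vertices of the trees in `F` that are contained in `[k]`. -/
def numSpecial (k : ℕ) (F : List RTree) : ℕ :=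
  (vertsOf F ∩ Finset.Icc 1 k).card

/-- The conditions on the trees of `(T₀, …, T_ℓ)` for it to be `k`-good. In the third case
`(T₀, T₁, …, T_ℓ)` is `T₀ :: T₁ :: R`, so that `ℓ = R.length + 1`, and `(T₀, …, T_i)` consists of
the first `i + 1` trees. -/
def GoodCondition (k : ℕ) : List RTree → Prop
  | [] => False
  | [T₀] => Disjoint T₀.verts (Finset.Icc 1 k) ∨ ∃ v ∈ Finset.Icc 1 k, T₀.verts = {v}
  | T₀ :: T₁ :: R =>
      (∀ T ∈ T₁ :: R, T.IsMinimallyRooted) ∧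
      (∀ i, i < R.length + 1 → i + 1 ≤ numSpecial k ((T₀ :: T₁ :: R).take (i + 1))) ∧
      numSpecial k (T₀ :: T₁ :: R) = R.length + 1

/-- `k`-good ordered forests. -/
def IsGood (k : ℕ) (F : List RTree) : Prop :=
  IsOrderedForest F ∧ GoodCondition k F

/-- Rooted trees on `[n+1]` whose maximal decreasing subtree has `k+1` vertices. -/
def setT (n k : ℕ) : Set RTree :=
  {T | T.verts = Finset.Icc 1 (n + 1) ∧
    ∃ M : RTree, M.IsMaximalDecreasingSubtree T ∧ M.verts.card = k + 1}

/-- Cycles of `k+1` minimally rooted trees whose vertex sets form a partition of `[n+1]`. -/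
def setA (n k : ℕ) : Set (Cycle RTree) :=
  {c | ∃ F : List RTree, (F : Cycle RTree) = c ∧ F.length = k + 1 ∧
    (∀ T ∈ F, T.IsMinimallyRooted) ∧ IsOrderedForestOn F (Finset.Icc 1 (n + 1))}

/-- Ordered forests on `[n]` with at least `k` trees, the last `k` of which are minimally
rooted. -/
def setB (n k : ℕ) : Set (List RTree) :=
  {F | IsOrderedForestOn F (Finset.Icc 1 n) ∧
    ∃ X Y : List RTree, F = X ++ Y ∧ Y.length = k ∧ ∀ T ∈ Y, T.IsMinimallyRooted}

/-- Sequences of `k`-good ordered forests whose vertex sets form a partition of `[n]`. -/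
def setC (n k : ℕ) : Set (List (List RTree)) :=
  {L | (∀ F ∈ L, IsGood k F) ∧
    (L.Pairwise fun F G => Disjoint (vertsOf F) (vertsOf G)) ∧
    ∀ v, v ∈ Finset.Icc 1 n ↔ ∃ F ∈ L, v ∈ vertsOf F}

/-- Rooted trees on `[n+1]` in which `n+1` is a leaf and `1, …, k` are nonleaves. -/
def setF (n k : ℕ) : Set RTree :=
  {T | T.verts = Finset.Icc 1 (n + 1) ∧ T.IsLeaf (n + 1) ∧
    ∀ i ∈ Finset.Icc 1 k, T.IsNonleaf i}

/-- Functions `[n] → [n]` whose image contains `[k]`. -/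
def setFun (n k : ℕ) : Set (Finset.Icc 1 n → Finset.Icc 1 n) :=
  {f | ∀ i ∈ Finset.Icc 1 k, ∃ x, (f x : ℕ) = i}

end LabelledTrees

namespace LabelledTrees

open Finset

/-! The proof is enumerative: each set has `commonNum n k` elements, and the equivalences come from
equality of finite cardinalities.

Write T for the exponential generating function of rooted trees, M for that of minimally rooted
trees, and W for that of all self-maps, with coefficients n^n. Minimally rooted trees on m > 0
vertices number (m-1)^(m-1) (`encard_minTrees`), so M' = W. Moreover (1 - T) W = 1
(`one_sub_treeSeries_mul`), and the series F of forests with one given root, which is classically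
e^T, satisfies F (1 - M) = 1 (`forestSeries_mul_one_sub`). The common number is n! times the
coefficient of x^n in M^k W.

Cycles (A): lists of k+1 minimally rooted trees on n+1 points are counted by (M^(k+1))' = (k+1) M^k
W, and each cycle comes from k+1 lists.

Forests (B): M^k W = M^k / (1 - T) describes arbitrary trees followed by k minimally rooted ones.

Good sequences (C): read tree by tree, a good forest is a walk that hits 0 for the first time at its
end. Counting partial configurations by the current height gives a recursion that the numbers
`commonNum` also satisfy (`countIs_passageSeqs`).

Maximal decreasing subtrees (T): once its vertex set D with k+1 elements is fixed, there are k!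
decreasing trees on D. The rest is a forest with root set D whose components are minimally rooted,
and summing over D gives the coefficient of M^(k+1) divided by (k+1)!
(`factorial_mul_sum_minForestNum`).

Leaves (F) and maps: prescribing that the points of S are leaves, or are missed by the map, leaves
(n - |S|)^n objects. This is also the coefficient of (1 - M)^|S| W (`egfCount_one_sub_pow_mul`), so
requiring a point to be hit replaces a factor 1 - M by 1 - (1 - M) = M. -/

theorem encard_eq_sum {α ι : Type*} (s : Set α) (I : Finset ι) (Q : ι → α → Prop)
    (h : ∀ a ∈ s, ∃! i, i ∈ I ∧ Q i a) : s.encard = ∑ i ∈ I, {a ∈ s | Q i a}.encard := by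
  have hU : s = ⋃ i ∈ (I : Set ι), {a ∈ s | Q i a} := by
    ext a
    simp only [Set.mem_iUnion, Set.mem_ofPred_eq, Finset.mem_coe, exists_prop]
    constructor
    · intro ha
      obtain ⟨i, hi, -⟩ := h a ha
      exact ⟨i, hi.1, ha, hi.2⟩
    · rintro ⟨i, -, ha, -⟩
      exact ha
  conv_lhs => rw [hU]
  rw [Set.Finite.encard_biUnion I.finite_toSet, finsum_mem_coe_finset]
  intro i hi j hj hij
  refine Set.disjoint_left.2 ?_
  rintro a ⟨ha, hia⟩ ⟨-, hja⟩
  exact hij ((h a ha).unique ⟨hi, hia⟩ ⟨hj, hja⟩)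

theorem encard_eq_of_inv {α β : Type*} {s : Set α} {t : Set β} (f : α → β) (g : β → α)
    (hf : ∀ a ∈ s, f a ∈ t) (hg : ∀ b ∈ t, g b ∈ s) (hgf : ∀ a ∈ s, g (f a) = a)
    (hfg : ∀ b ∈ t, f (g b) = b) : s.encard = t.encard :=
  Set.encard_congr (Set.BijOn.equiv f (Set.InvOn.bijOn ⟨hgf, hfg⟩ hf hg))

theorem encard_prod_eq {α β : Type*} (s : Set α) (t : Set β) :
    (s ×ˢ t).encard = s.encard * t.encard := by
  rw [Set.encard, Set.encard, Set.encard, ← ENat.card_prod]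
  exact ENat.card_congr (Equiv.Set.prod s t)

/-! ### Rooted forests as parent functions -/

/-- Functions that are the identity off `Z` and send each `v ∈ Z` into `t v`. -/
def piFun (Z : Finset ℕ) (t : ℕ → Finset ℕ) : Set (ℕ → ℕ) :=
  {g | (∀ v ∉ Z, g v = v) ∧ ∀ v ∈ Z, g v ∈ t v}

theorem encard_piFun (Z : Finset ℕ) (t : ℕ → Finset ℕ) :
    (piFun Z t).encard = ((∏ v ∈ Z, #(t v) : ℕ) : ℕ∞) := by
  rw [← Finset.card_pi, ← Set.encard_coe_eq_coe_finsetCard]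
  classical
  refine encard_eq_of_inv (fun g v _ => g v) (fun g v => if h : v ∈ Z then g v h else v)
    ?_ ?_ ?_ ?_
  · intro g hg
    simpa using fun v hv => hg.2 v hv
  · intro g hg
    simp only [Finset.mem_coe, Finset.mem_pi] at hg
    exact ⟨fun v hv => by simp [hv], fun v hv => by simpa [hv] using hg v hv⟩
  · intro g hg
    funext v
    by_cases hv : v ∈ Z
    · simp [hv]
    · simp [hv, hg.1 v hv]
  · intro g hg
    funext v hv
    simp [hv]

/-- Parent functions of rooted forests with set of roots `R` and set of nonroots `X` in which each
child `v` of a root `u` satisfies `c u v`. -/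
def forests (c : ℕ → ℕ → Prop) (X R : Finset ℕ) : Set (ℕ → ℕ) :=
  {p | (∀ v ∉ X, p v = v) ∧ (∀ v ∈ X, p v ∈ X ∪ R) ∧ (∀ v ∈ X, p v ∈ R → c (p v) v) ∧
    ∀ S ⊆ X, (∀ v ∈ S, p v ∈ S) → S = ∅}

theorem forests_apply_ne {c : ℕ → ℕ → Prop} {X R : Finset ℕ} {p : ℕ → ℕ} (hp : p ∈ forests c X R)
    {v : ℕ} (hv : v ∈ X) : p v ≠ v := by
  intro h
  have := hp.2.2.2 {v} (by simpa using hv) (by simpa using h)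
  simp at this

/-- The forests in which `Z` is the set of children of the roots. -/
theorem encard_forests_layer (c : ℕ → ℕ → Prop) [DecidableRel c] {X R Z : Finset ℕ}
    (hXR : Disjoint X R) (hZ : Z ⊆ X) :
    {p ∈ forests c X R | ∀ v ∈ X, v ∈ Z ↔ p v ∈ R}.encard =
      ((∏ v ∈ Z, #{u ∈ R | c u v} : ℕ) : ℕ∞) * (forests (fun _ _ => True) (X \ Z) Z).encard := by
  rw [← encard_piFun Z (fun v => {u ∈ R | c u v}), ← encard_prod_eq]
  have hXR' : ∀ v ∈ X, v ∉ R := fun v h => Finset.disjoint_left.1 hXR h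
  refine encard_eq_of_inv
    (fun p => (fun v => if v ∈ Z then p v else v, fun v => if v ∈ X \ Z then p v else v))
    (fun q v => if v ∈ Z then q.1 v else q.2 v) ?_ ?_ ?_ ?_
  · rintro p ⟨⟨h1, h2, h3, h4⟩, h5⟩
    refine ⟨⟨fun v hv => by simp [hv], fun v hv => ?_⟩, fun v hv => by simp only [if_neg hv],
      fun v hv => ?_, by simp, fun S hS hinv => ?_⟩
    · have := (h5 v (hZ hv)).1 hv
      simp [hv, this, h3 v (hZ hv) this]
    · have hv' := Finset.mem_sdiff.1 hv
      have a := h2 v hv'.1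
      have b := (h5 v hv'.1).not.1 hv'.2
      simp only [if_pos hv]
      simp only [Finset.mem_union, b, or_false] at a
      by_cases hz : p v ∈ Z <;> simp [a, hz]
    · refine h4 S (hS.trans Finset.sdiff_subset) fun v hv => ?_
      have := hinv v hv
      dsimp only at this
      rwa [if_pos (hS hv)] at this
  · rintro ⟨g, q⟩ ⟨⟨g1, g2⟩, q1, q2, -, q4⟩
    simp only [Finset.mem_filter] at g2
    have key : ∀ v ∈ X, v ∈ Z ↔ (if v ∈ Z then g v else q v) ∈ R := by
      intro v hv
      by_cases hz : v ∈ Z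
      · simp [hz, (g2 v hz).1]
      · simp only [hz, if_false, false_iff]
        have := q2 v (Finset.mem_sdiff.2 ⟨hv, hz⟩)
        rw [Finset.sdiff_union_of_subset hZ] at this
        exact hXR' _ this
    refine ⟨⟨fun v hv => ?_, fun v hv => ?_, fun v hv hR => ?_, fun S hS hinv => ?_⟩, key⟩
    · have hz : v ∉ Z := fun h => hv (hZ h)
      simp only [hz, if_false]
      exact q1 v (by simp [hv])
    · by_cases hz : v ∈ Z
      · simp [hz, (g2 v hz).1]
      · simp only [hz, if_false]
        have := q2 v (Finset.mem_sdiff.2 ⟨hv, hz⟩)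
        rw [Finset.sdiff_union_of_subset hZ] at this
        exact Finset.mem_union_left _ this
    · have hz := (key v hv).2 hR
      simpa only [hz, if_true] using (g2 v hz).2
    -- An element of `Z` is sent to `R`, hence out of `S ⊆ X`.
    · have hSZ : ∀ v ∈ S, v ∉ Z := fun v hv hz =>
        hXR' _ (hS (hinv v hv)) ((key v (hS hv)).1 hz)
      refine q4 S (fun v hv => Finset.mem_sdiff.2 ⟨hS hv, hSZ v hv⟩) fun v hv => ?_
      have := hinv v hv
      dsimp only at this
      rwa [if_neg (hSZ v hv)] at this
  · rintro p ⟨hp, h5⟩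
    funext v
    by_cases hz : v ∈ Z
    · simp [hz]
    · by_cases hX : v ∈ X
      · simp [hz, hX]
      · simp [hz, hX, hp.1 v hX]
  · rintro ⟨g, q⟩ ⟨⟨g1, g2⟩, q1, -⟩
    refine Prod.ext (funext fun v => ?_) (funext fun v => ?_)
    · by_cases hz : v ∈ Z
      · simp [hz]
      · simp only [hz, if_false]
        exact (g1 v hz).symm
    · by_cases hz : v ∈ X \ Z
      · simp [(Finset.mem_sdiff.1 hz).1, (Finset.mem_sdiff.1 hz).2]
      · simp only [hz, if_false]
        exact (q1 v hz).symm

theorem encard_forests_eq_sum_layer (c : ℕ → ℕ → Prop) [DecidableRel c] {X R : Finset ℕ}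
    (hXR : Disjoint X R) :
    (forests c X R).encard = ∑ Z ∈ X.powerset, ((∏ v ∈ Z, #{u ∈ R | c u v} : ℕ) : ℕ∞) *
      (forests (fun _ _ => True) (X \ Z) Z).encard := by
  rw [encard_eq_sum _ X.powerset (fun Z p => ∀ v ∈ X, v ∈ Z ↔ p v ∈ R)]
  · exact Finset.sum_congr rfl fun Z hZ =>
      encard_forests_layer c hXR (Finset.mem_powerset.1 hZ)
  · intro p hp
    refine ⟨{v ∈ X | p v ∈ R}, ⟨by simp, fun v hv => by simp [hv]⟩, ?_⟩
    rintro Z ⟨hZ, h⟩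
    ext v
    rw [Finset.mem_filter]
    exact ⟨fun hv => ⟨Finset.mem_powerset.1 hZ hv, (h v (Finset.mem_powerset.1 hZ hv)).1 hv⟩,
      fun hv => (h v hv.1).2 hv.2⟩

/-- The number of rooted forests with `n` nonroots and `r` given roots. -/
def forestNum (n r : ℕ) : ℕ := if n = 0 then 1 else r * (n + r) ^ (n - 1)

/-- The factor `n` removes the case distinction in `forestNum`, so that binomial sums over all `z`
can be treated uniformly. -/
theorem mul_forestNum {n z : ℕ} (h : z ≤ n) : n * forestNum (n - z) z = z * n ^ (n - z) := by
  unfold forestNum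
  split_ifs with h0
  · have : z = n := by omega
    simp [this]
  · obtain ⟨m, rfl⟩ : ∃ m, n = z + m + 1 := ⟨n - z - 1, by omega⟩
    have h1 : z + m + 1 - z = m + 1 := by omega
    rw [h1, Nat.add_sub_cancel, pow_succ]
    have : m + 1 + z = z + m + 1 := by omega
    rw [this]
    ring

/-- After multiplication by `n`, absorbing z into C(n, z) leaves the binomial expansion of (r +
n)^(n-1). -/
theorem sum_choose_mul_forestNum {n : ℕ} (r : ℕ) (hn : n ≠ 0) :
    ∑ z ∈ range (n + 1), n.choose z * (r ^ z * forestNum (n - z) z) = forestNum n r := by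
  apply Nat.eq_of_mul_eq_mul_left (Nat.pos_of_ne_zero hn)
  rw [Finset.mul_sum]
  have : ∀ z ∈ range (n + 1), n * (n.choose z * (r ^ z * forestNum (n - z) z)) =
      n.choose z * z * r ^ z * n ^ (n - z) := by
    intro z hz
    have := mul_forestNum (n := n) (z := z) (by simp at hz; omega)
    calc _ = n.choose z * r ^ z * (n * forestNum (n - z) z) := by ring
      _ = _ := by rw [this]; ring
  rw [Finset.sum_congr rfl this, Finset.sum_range_succ']
  obtain ⟨m, rfl⟩ := Nat.exists_eq_succ_of_ne_zero hn
  simp only [forestNum, hn, if_false, Nat.succ_eq_add_one, Nat.add_sub_cancel, Nat.mul_zero,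
    Nat.zero_mul, add_zero, Nat.add_sub_add_right]
  have h2 := add_pow r (m + 1) m
  calc _ = ∑ z ∈ range (m + 1), (m + 1) * (r * (r ^ z * (m + 1) ^ (m - z) * m.choose z)) := by
        refine Finset.sum_congr rfl fun z _ => ?_
        rw [← Nat.add_one_mul_choose_eq]; ring
    _ = _ := by rw [← Finset.mul_sum, ← Finset.mul_sum]; push_cast at h2 ⊢; rw [← h2]; ring

theorem forests_empty_left (c : ℕ → ℕ → Prop) (R : Finset ℕ) : forests c ∅ R = {id} := by
  ext p
  simp only [forests, Set.mem_ofPred_eq, Set.mem_singleton_iff]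
  constructor
  · rintro ⟨h, -⟩
    exact funext fun v => h v (by simp)
  · rintro rfl
    simp +contextual

theorem forests_empty_right (c : ℕ → ℕ → Prop) {X : Finset ℕ} (hX : X.Nonempty) :
    forests c X ∅ = ∅ := by
  ext p
  simp only [Set.mem_empty_iff_false, iff_false]
  rintro ⟨-, h2, -, h4⟩
  exact hX.ne_empty (h4 X subset_rfl (by simpa using h2))

/-- Deleting the roots turns their set of children `Z` into the new root set, which gives the
recursion of `sum_choose_mul_forestNum`. -/
theorem encard_forests_true {X R : Finset ℕ} (hXR : Disjoint X R) :
    (forests (fun _ _ => True) X R).encard = (forestNum #X #R : ℕ) := by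
  induction hn : #X using Nat.strong_induction_on generalizing X R with
  | _ n ih =>
  rcases X.eq_empty_or_nonempty with rfl | hX
  · subst hn
    simp [forests_empty_left, forestNum]
  have hn0 : n ≠ 0 := by
    rw [← hn]; exact hX.card_pos.ne'
  rw [encard_forests_eq_sum_layer _ hXR, ← sum_choose_mul_forestNum _ hn0, ← hn]
  have := Finset.sum_powerset_apply_card (fun z => (#R ^ z * forestNum (#X - z) z)) (x := X)
  simp only [smul_eq_mul] at this
  rw [← this, Nat.cast_sum]
  refine Finset.sum_congr rfl fun Z hZ => ?_
  have hZX := Finset.mem_powerset.1 hZ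
  simp only [Finset.filter_true, Finset.prod_const, Nat.cast_mul]
  congr 1
  -- For empty `Z` the set of nonroots does not shrink and induction is not available, but then
  -- there is no forest at all.
  rcases Z.eq_empty_or_nonempty with rfl | hZn
  · rw [Finset.sdiff_empty, forests_empty_right _ hX]
    have : #X ≠ 0 := hX.card_pos.ne'
    simp [forestNum, this]
  · have h1 : #(X \ Z) = #X - #Z := Finset.card_sdiff_of_subset hZX
    have h2 := hZn.card_pos
    have h3 := Finset.card_le_card hZX
    rw [ih #(X \ Z) (by omega) Finset.sdiff_disjoint rfl, h1]

/-- Splitting off the component of one root. -/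
theorem encard_forests_component (c : ℕ → ℕ → Prop) {X R V : Finset ℕ} {r : ℕ}
    (hXR : Disjoint X R) (hr : r ∉ R) (hrX : r ∉ X) (hV : V ⊆ X) :
    {p ∈ forests c X (insert r R) | ∀ v ∈ X, (v ∈ V → p v ∈ insert r V) ∧
      (v ∉ V → p v ∈ X \ V ∪ R)}.encard =
      (forests c V {r}).encard * (forests c (X \ V) R).encard := by
  rw [← encard_prod_eq]
  have hXR' : ∀ v ∈ X, v ∉ R := fun v h => Finset.disjoint_left.1 hXR h
  refine encard_eq_of_inv
    (fun p => (fun v => if v ∈ V then p v else v, fun v => if v ∈ X \ V then p v else v))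
    (fun q v => if v ∈ V then q.1 v else q.2 v) ?_ ?_ ?_ ?_
  · rintro p ⟨⟨h1, h2, h3, h4⟩, h5⟩
    refine ⟨⟨fun v hv => by simp [hv], fun v hv => ?_, fun v hv => ?_, fun S hS hinv => ?_⟩,
      fun v hv => by simp only [if_neg hv],
      fun v hv => ?_, fun v hv => ?_, fun S hS hinv => ?_⟩
    · have := (h5 v (hV hv)).1 hv
      simp only [hv, if_true]
      simpa [or_comm] using this
    · simp only [hv, if_true, Finset.mem_singleton]
      exact fun h => h3 v (hV hv) (by simp [h])
    · refine h4 S (hS.trans hV) fun v hv => ?_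
      have := hinv v hv
      dsimp only at this
      rwa [if_pos (hS hv)] at this
    · simp only [if_pos hv]
      exact (h5 v (Finset.mem_sdiff.1 hv).1).2 (Finset.mem_sdiff.1 hv).2
    · simp only [if_pos hv]
      exact fun h => h3 v (Finset.mem_sdiff.1 hv).1 (by simp [h])
    · refine h4 S (hS.trans Finset.sdiff_subset) fun v hv => ?_
      have := hinv v hv
      dsimp only at this
      rwa [if_pos (hS hv)] at this
  · rintro ⟨g, q⟩ ⟨⟨g1, g2, g3, g4⟩, q1, q2, q3, q4⟩
    have hq2 : ∀ v ∈ X, v ∉ V → q v ∈ X \ V ∪ R := fun v hv hvV =>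
      q2 v (Finset.mem_sdiff.2 ⟨hv, hvV⟩)
    refine ⟨⟨fun v hv => ?_, fun v hv => ?_, fun v hv hR => ?_, fun S hS hinv => ?_⟩,
      fun v hv => ⟨fun hz => ?_, fun hz => ?_⟩⟩
    · have hz : v ∉ V := fun h => hv (hV h)
      simp only [hz, if_false]
      exact q1 v (by simp [hv])
    · by_cases hz : v ∈ V
      · have := g2 v hz
        simp only [hz, if_true]
        simp only [Finset.mem_union, Finset.mem_singleton, Finset.mem_insert] at this ⊢
        exact this.elim (fun h => .inl (hV h)) fun h => .inr (.inl h)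
      · have := hq2 v hv hz
        simp only [hz, if_false]
        simp only [Finset.mem_union, Finset.mem_sdiff, Finset.mem_insert] at this ⊢
        tauto
    · by_cases hz : v ∈ V
      · simp only [hz, if_true] at hR ⊢
        refine g3 v hz ?_
        have := g2 v hz
        simp only [Finset.mem_union, Finset.mem_singleton, Finset.mem_insert] at this hR ⊢
        rcases this with h | h
        · exact hR.elim id fun h' => absurd h' (hXR' _ (hV h))
        · exact h
      · simp only [hz, if_false] at hR ⊢
        refine q3 v (Finset.mem_sdiff.2 ⟨hv, hz⟩) ?_
        have := hq2 v hv hz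
        simp only [Finset.mem_union, Finset.mem_sdiff, Finset.mem_insert] at this hR ⊢
        rcases hR with h | h
        · rw [h] at this
          exact this.elim (fun h' => absurd h'.1 hrX) fun h' => absurd h' hr
        · exact h
    -- An invariant set meets `V` in a set invariant under `g`; the value `r` is impossible because
    -- `r ∉ X`.
    · have hSV : S ∩ V = ∅ := by
        refine g4 _ Finset.inter_subset_right fun v hv => ?_
        obtain ⟨hvS, hvV⟩ := Finset.mem_inter.1 hv
        have h := hinv v hvS
        simp only [hvV, if_true] at h
        have := g2 v hvV
        simp only [Finset.mem_union, Finset.mem_singleton] at this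
        refine Finset.mem_inter.2 ⟨h, this.elim id fun h' => ?_⟩
        rw [h'] at h
        exact absurd (hS h) hrX
      have hSV' : ∀ v ∈ S, v ∉ V := fun v hv hz => by
        have := Finset.mem_inter.2 ⟨hv, hz⟩
        simp [hSV] at this
      refine q4 S (fun v hv => Finset.mem_sdiff.2 ⟨hS hv, hSV' v hv⟩) fun v hv => ?_
      have := hinv v hv
      dsimp only at this
      rwa [if_neg (hSV' v hv)] at this
    · simp only [hz, if_true]
      simpa [or_comm] using g2 v hz
    · simp only [hz, if_false]
      exact hq2 v hv hz
  · rintro p ⟨hp, -⟩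
    funext v
    by_cases hz : v ∈ V
    · simp [hz]
    · by_cases hX : v ∈ X
      · simp [hz, hX]
      · simp [hz, hX, hp.1 v hX]
  · rintro ⟨g, q⟩ ⟨⟨g1, -⟩, q1, -⟩
    refine Prod.ext (funext fun v => ?_) (funext fun v => ?_)
    · by_cases hz : v ∈ V
      · simp [hz]
      · simp only [hz, if_false]
        exact (g1 v hz).symm
    · by_cases hz : v ∈ X \ V
      · simp [(Finset.mem_sdiff.1 hz).1, (Finset.mem_sdiff.1 hz).2]
      · simp only [hz, if_false]
        exact (q1 v hz).symm

/-- The set `V` consists of the nonroots in the component of `r`; the remaining vertices form a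
forest over `R`. -/
theorem encard_forests_insert (c : ℕ → ℕ → Prop) {X R : Finset ℕ} {r : ℕ}
    (hXR : Disjoint X R) (hr : r ∉ R) (hrX : r ∉ X) :
    (forests c X (insert r R)).encard =
      ∑ V ∈ X.powerset, (forests c V {r}).encard * (forests c (X \ V) R).encard := by
  have hXR' : ∀ v ∈ X, v ∉ R := fun v h => Finset.disjoint_left.1 hXR h
  rw [encard_eq_sum _ X.powerset (fun V p => ∀ v ∈ X, (v ∈ V → p v ∈ insert r V) ∧
      (v ∉ V → p v ∈ X \ V ∪ R))]
  · exact Finset.sum_congr rfl fun V hV =>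
      encard_forests_component c hXR hr hrX (Finset.mem_powerset.1 hV)
  · rintro p ⟨h1, h2, h3, h4⟩
    -- Two candidates for the component agree because `V \ V'` is invariant under `p`, hence empty.
    have uniq : ∀ V V' : Finset ℕ, V ⊆ X →
        (∀ v ∈ X, (v ∈ V → p v ∈ insert r V) ∧ (v ∉ V → p v ∈ X \ V ∪ R)) →
        (∀ v ∈ X, (v ∈ V' → p v ∈ insert r V') ∧ (v ∉ V' → p v ∈ X \ V' ∪ R)) → V ⊆ V' := by
      intro V V' hV h h'
      rw [← Finset.sdiff_eq_empty_iff_subset]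
      refine h4 _ (Finset.sdiff_subset.trans hV) fun v hv => ?_
      obtain ⟨hv1, hv2⟩ := Finset.mem_sdiff.1 hv
      have a := (h v (hV hv1)).1 hv1
      have b := (h' v (hV hv1)).2 hv2
      simp only [Finset.mem_union, Finset.mem_sdiff, Finset.mem_insert] at a b ⊢
      rcases a with a | a
      · rw [a] at b
        exact b.elim (fun h => absurd h.1 hrX) fun h => absurd h hr
      · exact ⟨a, b.elim (fun h => h.2) fun h => absurd h (hXR' _ (hV a))⟩
    -- The largest set that `p` maps into itself together with `R`: the nonroots whose ancestors
    -- lead to `R`. Its complement in `X` is the component of `r`.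
    let U : Finset ℕ := {S ∈ X.powerset | ∀ v ∈ S, p v ∈ S ∪ R}.sup id
    have hU : U ⊆ X := by
      simp only [U, Finset.sup_le_iff, Finset.mem_filter, Finset.mem_powerset]
      exact fun S hS => hS.1
    have hUinv : ∀ v ∈ U, p v ∈ U ∪ R := by
      intro v hv
      simp only [U, Finset.mem_sup, id] at hv
      obtain ⟨S, hS, hvS⟩ := hv
      have hSU : S ⊆ U := Finset.le_sup (f := id) hS
      exact Finset.union_subset_union_left hSU ((Finset.mem_filter.1 hS).2 v hvS)
    have hUmax : ∀ v ∈ X, p v ∈ U ∪ R → v ∈ U := by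
      intro v hv hpv
      have : insert v U ∈ {S ∈ X.powerset | ∀ v ∈ S, p v ∈ S ∪ R} := by
        simp only [Finset.mem_filter, Finset.mem_powerset]
        refine ⟨Finset.insert_subset hv hU, fun w hw => ?_⟩
        refine Finset.union_subset_union_left (Finset.subset_insert v U) ?_
        rcases Finset.mem_insert.1 hw with rfl | hw
        · exact hpv
        · exact hUinv w hw
      exact (Finset.le_sup (f := id) this) (Finset.mem_insert_self v U)
    have hex : ∀ v ∈ X, (v ∈ X \ U → p v ∈ insert r (X \ U)) ∧
        (v ∉ X \ U → p v ∈ X \ (X \ U) ∪ R) := by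
      intro v hv
      rw [Finset.sdiff_sdiff_eq_self hU]
      refine ⟨fun h => ?_, fun h => hUinv v (by simp [hv] at h; exact h)⟩
      have a := h2 v hv
      have b := mt (hUmax v hv) (Finset.mem_sdiff.1 h).2
      simp only [Finset.mem_union, Finset.mem_insert, Finset.mem_sdiff] at a b ⊢
      tauto
    refine ⟨X \ U, ⟨by simp, hex⟩, ?_⟩
    rintro V ⟨hV, h⟩
    exact (uniq V _ (Finset.mem_powerset.1 hV) h hex).antisymm
      (uniq _ V Finset.sdiff_subset hex h)

/-! ### Rooted trees and their parent functions -/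

namespace RTree

/-- All edges join members of `verts`, so a cycle would already live in the induced graph. -/
theorem graph_isAcyclic (T : RTree) : T.graph.IsAcyclic := by
  intro v c hc
  have hs : ∀ x ∈ c.support, x ∈ (T.verts : Set ℕ) := by
    intro x hx
    rw [SimpleGraph.Walk.mem_support_iff_exists_mem_edges_of_not_nil hc.not_nil] at hx
    obtain ⟨e, he, hxe⟩ := hx
    induction e with
    | _ a b =>
      have := T.mem_of_adj a b (c.adj_of_mem_edges he)
      rcases Sym2.mem_iff.1 hxe with rfl | rfl
      · exact this.1
      · exact this.2
  refine T.isTree.isAcyclic (c.induce _ hs) ?_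
  refine SimpleGraph.Walk.IsCycle.of_map
    (f := (SimpleGraph.Embedding.induce (T.verts : Set ℕ)).toHom) ?_
  rwa [SimpleGraph.Walk.map_induce]

theorem reachable (T : RTree) {v : ℕ} (hv : v ∈ T.verts) : T.graph.Reachable T.root v := by
  have := T.isTree.connected.preconnected ⟨T.root, T.root_mem⟩ ⟨v, hv⟩
  exact this.map (SimpleGraph.Embedding.induce _).toHom

theorem mem_verts_of_walk (T : RTree) {v : ℕ} (p : T.graph.Walk T.root v) : v ∈ T.verts := by
  by_cases h : p.Nil
  · rw [← h.eq]; exact T.root_mem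
  · exact (T.mem_of_adj _ _ (p.adj_penultimate h)).2

theorem isChild_unique (T : RTree) {u u' v : ℕ} (h : T.IsChild u v) (h' : T.IsChild u' v) :
    u = u' := by
  obtain ⟨-, p, hp, rfl⟩ := h
  obtain ⟨-, q, hq, rfl⟩ := h'
  have := (T.graph_isAcyclic.subsingleton_path _ _).elim ⟨p, hp⟩ ⟨q, hq⟩
  rw [Subtype.mk.injEq] at this
  rw [this]

theorem exists_isChild (T : RTree) {v : ℕ} (hv : v ∈ T.verts) (hr : v ≠ T.root) :
    ∃ u, T.IsChild u v ∧ T.graph.dist T.root u < T.graph.dist T.root v := by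
  obtain ⟨p, hp, hd⟩ := (T.reachable hv).exists_path_of_dist
  refine ⟨p.penultimate, ⟨hr, p, hp, rfl⟩, ?_⟩
  have hn : ¬ p.Nil := fun h => hr h.eq.symm
  have h1 := SimpleGraph.dist_le p.dropLast
  have h2 := SimpleGraph.Walk.length_dropLast_add_one hn
  omega

theorem IsChild.adj {T : RTree} {u v : ℕ} (h : T.IsChild u v) : T.graph.Adj u v := by
  obtain ⟨hr, p, hp, rfl⟩ := h
  exact p.adj_penultimate fun h => hr h.eq.symm

/-- The path from the root to `u` either contains `v`, which is then its penultimate vertex by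
acyclicity, or extends to a path to `v`. -/
theorem adj_iff (T : RTree) {u v : ℕ} : T.graph.Adj u v ↔ T.IsChild u v ∨ T.IsChild v u := by
  classical
  refine ⟨fun h => ?_, fun h => h.elim IsChild.adj fun h => h.adj.symm⟩
  obtain ⟨p, hp, -⟩ := (T.reachable (T.mem_of_adj _ _ h).1).exists_path_of_dist
  by_cases hv : v ∈ p.support
  · right
    refine ⟨?_, p, hp, ?_⟩
    · rintro rfl
      rw [SimpleGraph.Walk.nil_iff_support_eq.1 (SimpleGraph.Walk.isPath_iff_nil.1 hp)] at hv
      exact h.ne (List.mem_singleton.1 hv).symm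
    · exact (T.graph_isAcyclic.eq_penultimate_of_adj_end hp h hv).symm
  · left
    refine ⟨?_, p.concat h, hp.concat hv h, by simp⟩
    rintro rfl
    exact hv p.start_mem_support

/-- The parent of a vertex other than the root; every other number is sent to itself. -/
noncomputable def parent (T : RTree) (v : ℕ) : ℕ :=
  open Classical in if h : ∃ u, T.IsChild u v then h.choose else v

theorem isChild_iff (T : RTree) {u v : ℕ} :
    T.IsChild u v ↔ v ∈ T.verts.erase T.root ∧ T.parent v = u := by
  constructor
  · intro h
    obtain ⟨hr, p, -⟩ := id h
    refine ⟨Finset.mem_erase.2 ⟨hr, T.mem_verts_of_walk p⟩, ?_⟩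
    have hex : ∃ u, T.IsChild u v := ⟨u, h⟩
    rw [parent, dif_pos hex]
    exact T.isChild_unique hex.choose_spec h
  · rintro ⟨hv, rfl⟩
    obtain ⟨hr, hv⟩ := Finset.mem_erase.1 hv
    obtain ⟨u, h, -⟩ := T.exists_isChild hv hr
    have hex : ∃ u, T.IsChild u v := ⟨u, h⟩
    rw [parent, dif_pos hex]
    exact hex.choose_spec

theorem isChild_parent (T : RTree) {v : ℕ} (hv : v ∈ T.verts.erase T.root) :
    T.IsChild (T.parent v) v :=
  T.isChild_iff.2 ⟨hv, rfl⟩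

theorem parent_mem (T : RTree) {v : ℕ} (hv : v ∈ T.verts.erase T.root) : T.parent v ∈ T.verts :=
  (T.mem_of_adj _ _ (T.isChild_parent hv).adj).1

theorem dist_parent_lt (T : RTree) {v : ℕ} (hv : v ∈ T.verts.erase T.root) :
    T.graph.dist T.root (T.parent v) < T.graph.dist T.root v := by
  obtain ⟨u, h, hd⟩ := T.exists_isChild (Finset.mem_erase.1 hv).2 (Finset.mem_erase.1 hv).1
  rwa [(T.isChild_iff.1 h).2]

/-- In a nonempty invariant set of nonroots, a vertex closest to the root would have a still closer
parent. -/
theorem parent_mem_forests (T : RTree) :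
    T.parent ∈ forests (fun _ _ => True) (T.verts.erase T.root) {T.root} := by
  refine ⟨fun v hv => ?_, fun v hv => ?_, by simp, fun S hS hinv => ?_⟩
  · have : ¬ ∃ u, T.IsChild u v := by
      rintro ⟨u, h⟩
      exact hv (T.isChild_iff.1 h).1
    rw [parent, dif_neg this]
  · rw [Finset.union_comm, ← Finset.insert_eq, Finset.insert_erase T.root_mem]
    exact T.parent_mem hv
  · by_contra hne
    obtain ⟨v, hv, hmin⟩ := Finset.exists_min_image S (fun v => T.graph.dist T.root v)
      (Finset.nonempty_iff_ne_empty.2 hne)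
    exact absurd (hmin _ (hinv v hv)) (not_le.2 (T.dist_parent_lt (hS hv)))

theorem adj_iff_parent (T : RTree) {u v : ℕ} :
    T.graph.Adj u v ↔ u ≠ v ∧ (T.parent u = v ∨ T.parent v = u) := by
  have key : ∀ u v, u ≠ v → T.parent v = u → T.IsChild u v := by
    intro u v huv h
    refine T.isChild_iff.2 ⟨?_, h⟩
    by_contra hv
    exact huv ((T.parent_mem_forests.1 v hv ▸ h).symm)
  constructor
  · intro h
    refine ⟨h.ne, ?_⟩
    rw [adj_iff, isChild_iff, isChild_iff] at h
    tauto
  · rintro ⟨hne, h | h⟩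
    · exact (key v u hne.symm h).adj.symm
    · exact (key u v hne h).adj

theorem ext_parent {S T : RTree} (hv : S.verts = T.verts) (hr : S.root = T.root)
    (hp : S.parent = T.parent) : S = T := by
  refine RTree.ext hv ?_ hr
  ext u v
  rw [adj_iff_parent, adj_iff_parent, hp]

section ofParent

variable {V : Finset ℕ} {r : ℕ} {p : ℕ → ℕ} {c : ℕ → ℕ → Prop}

/-- The vertices not connected to `r` form a set invariant under `p`, so the graph is connected. The
edges are images of the nonroots under v ↦ {v, p v}, so there are at most |V| - 1 of them. -/
theorem isTree_fromRel (hr : r ∈ V) (hp : p ∈ forests c (V.erase r) {r}) :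
    ((SimpleGraph.fromRel fun u v => p u = v).induce (V : Set ℕ)).IsTree := by
  classical
  obtain ⟨-, h2, -, h4⟩ := id hp
  set G := (SimpleGraph.fromRel fun u v => p u = v).induce (V : Set ℕ) with hG
  have hpV : ∀ v ∈ V.erase r, p v ∈ V := by
    intro v hv
    have := h2 v hv
    rwa [Finset.union_comm, ← Finset.insert_eq, Finset.insert_erase hr] at this
  have hadj : ∀ v (hv : v ∈ V.erase r),
      G.Adj ⟨v, Finset.mem_of_mem_erase hv⟩ ⟨p v, hpV v hv⟩ := by
    intro v hv
    simp [hG, SimpleGraph.fromRel_adj, (forests_apply_ne hp hv).symm]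
  have hreach : ∀ v (hv : v ∈ V), G.Reachable ⟨v, hv⟩ ⟨r, hr⟩ := by
    have : {v ∈ V | ∃ hv : v ∈ V, ¬ G.Reachable ⟨v, hv⟩ ⟨r, hr⟩} = ∅ := by
      refine h4 _ (fun v hv => ?_) fun v hv => ?_
      · obtain ⟨hv, hv', h⟩ := Finset.mem_filter.1 hv
        refine Finset.mem_erase.2 ⟨?_, hv⟩
        rintro rfl
        exact h (SimpleGraph.Reachable.refl _)
      · obtain ⟨hv, hv', h⟩ := Finset.mem_filter.1 hv
        have hve : v ∈ V.erase r := by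
          refine Finset.mem_erase.2 ⟨?_, hv⟩
          rintro rfl
          exact h (SimpleGraph.Reachable.refl _)
        exact Finset.mem_filter.2 ⟨hpV v hve, hpV v hve, fun h' =>
          h ((hadj v hve).reachable.trans h')⟩
    intro v hv
    by_contra h
    have hm : v ∈ {v ∈ V | ∃ hv : v ∈ V, ¬ G.Reachable ⟨v, hv⟩ ⟨r, hr⟩} :=
      Finset.mem_filter.2 ⟨hv, hv, h⟩
    rw [this] at hm
    simp at hm
  have hconn : G.Connected := by
    have : Nonempty (V : Set ℕ) := ⟨⟨r, hr⟩⟩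
    exact ⟨fun u v => (hreach u.1 u.2).trans (hreach v.1 v.2).symm⟩
  rw [SimpleGraph.isTree_iff_connected_and_card]
  refine ⟨hconn, le_antisymm ?_ hconn.card_vert_le_card_edgeSet_add_one⟩
  have hsurj : Function.Surjective (fun v : V.erase r =>
      (⟨s(⟨v.1, Finset.mem_of_mem_erase v.2⟩, ⟨p v.1, hpV v.1 v.2⟩), hadj v.1 v.2⟩ :
        G.edgeSet)) := by
    rintro ⟨e, he⟩
    induction e with
    | _ a b =>
      obtain ⟨a, ha⟩ := a
      obtain ⟨b, hb⟩ := b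
      have he' : a ≠ b ∧ (p a = b ∨ p b = a) := he
      have hmem : ∀ a ∈ V, ∀ b, a ≠ b → p a = b → a ∈ V.erase r := by
        intro a ha b hab h
        by_contra hn
        exact hab (hp.1 a hn ▸ h)
      rcases he'.2 with h | h
      · refine ⟨⟨a, hmem a ha b he'.1 h⟩, ?_⟩
        simp [h]
      · refine ⟨⟨b, hmem b hb a he'.1.symm h⟩, ?_⟩
        simp [h]
  have h3 : Nat.card G.edgeSet ≤ Nat.card (V.erase r) :=
    Nat.card_le_card_of_surjective _ hsurj
  have h1 : Nat.card (V.erase r) = #V - 1 := by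
    rw [Nat.card_eq_fintype_card, Fintype.card_coe, Finset.card_erase_of_mem hr]
  have hpos : 0 < #V := Finset.card_pos.2 ⟨r, hr⟩
  have h2 : Nat.card (V : Set ℕ) = #V := by simp
  rw [h2]
  omega

/-- The rooted tree with vertex set `V`, root `r` and parent function `p`. -/
def ofParent (hr : r ∈ V) (hp : p ∈ forests c (V.erase r) {r}) : RTree where
  verts := V
  graph := SimpleGraph.fromRel fun u v => p u = v
  root := r
  root_mem := hr
  mem_of_adj := by
    have key : ∀ u v, u ≠ v → p u = v → u ∈ V ∧ v ∈ V := by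
      intro u v huv h
      have hu : u ∈ V.erase r := by
        by_contra hu
        exact huv (hp.1 u hu ▸ h)
      have := hp.2.1 u hu
      rw [Finset.union_comm, ← Finset.insert_eq, Finset.insert_erase hr, h] at this
      exact ⟨Finset.mem_of_mem_erase hu, this⟩
    rintro u v ⟨huv, h | h⟩
    · exact key u v huv h
    · exact (key v u huv.symm h).symm
  isTree := isTree_fromRel hr hp

/-- If the two parents of `v` differ, the edge from `v` to `p v` makes `v` the tree parent of `p v`.
The parents of `p v` then differ too, since otherwise `p` would have a 2-cycle; so the set of
disagreement is invariant. -/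
theorem parent_ofParent (hr : r ∈ V) (hp : p ∈ forests c (V.erase r) {r}) :
    (ofParent hr hp).parent = p := by
  set T := ofParent hr hp with hT
  have hq : T.parent ∈ forests (fun _ _ => True) (V.erase r) {r} := T.parent_mem_forests
  have hadj : ∀ u v, T.graph.Adj u v ↔ u ≠ v ∧ (p u = v ∨ p v = u) := fun u v => Iff.rfl
  have hS : {v ∈ V.erase r | T.parent v ≠ p v} = ∅ := by
    refine hp.2.2.2 _ (Finset.filter_subset _ _) fun v hv => ?_
    obtain ⟨hv, hne⟩ := Finset.mem_filter.1 hv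
    have h1 : T.graph.Adj v (p v) :=
      (hadj _ _).2 ⟨(forests_apply_ne hp hv).symm, Or.inl rfl⟩
    have h2 : T.parent (p v) = v := by
      rw [adj_iff_parent] at h1
      exact h1.2.resolve_left hne
    have h3 : p v ∈ V.erase r := by
      by_contra h
      exact h1.ne (h2.symm.trans (hq.1 _ h))
    refine Finset.mem_filter.2 ⟨h3, fun h => ?_⟩
    have := hp.2.2.2 {v, p v} (by simp [Finset.insert_subset_iff, hv, h3]) (by
      intro w hw
      rcases Finset.mem_insert.1 hw with rfl | hw
      · simp
      · rw [Finset.mem_singleton.1 hw, ← h, h2]; simp)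
    simp at this
  funext v
  by_cases hv : v ∈ V.erase r
  · by_contra h
    have hm : v ∈ {v ∈ V.erase r | T.parent v ≠ p v} := Finset.mem_filter.2 ⟨hv, h⟩
    rw [hS] at hm
    simp at hm
  · rw [hq.1 v hv, hp.1 v hv]

end ofParent

/-- Counting rooted trees with given vertex set and root by their parent functions. -/
theorem encard_trees_eq {V : Finset ℕ} {r : ℕ} (hr : r ∈ V) (P : (ℕ → ℕ) → Prop) :
    {T : RTree | T.verts = V ∧ T.root = r ∧ P T.parent}.encard =
      {p ∈ forests (fun _ _ => True) (V.erase r) {r} | P p}.encard := by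
  have himg : RTree.parent '' {T : RTree | T.verts = V ∧ T.root = r ∧ P T.parent} =
      {p ∈ forests (fun _ _ => True) (V.erase r) {r} | P p} := by
    ext p
    constructor
    · rintro ⟨T, ⟨rfl, rfl, h⟩, rfl⟩
      exact ⟨T.parent_mem_forests, h⟩
    · rintro ⟨hp, h⟩
      exact ⟨ofParent hr hp, ⟨rfl, rfl, by rwa [parent_ofParent]⟩, parent_ofParent hr hp⟩
  rw [← himg, Set.InjOn.encard_image]
  rintro S ⟨hS1, hS2, -⟩ T ⟨hT1, hT2, -⟩ h
  exact ext_parent (hS1.trans hT1.symm) (hS2.trans hT2.symm) h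

theorem isMinimallyRooted_iff (T : RTree) :
    T.IsMinimallyRooted ↔ ∀ v ∈ T.verts.erase T.root, T.parent v = T.root → T.root < v := by
  simp only [IsMinimallyRooted, isChild_iff, not_lt]
  refine ⟨fun h v hv hp => lt_of_le_of_ne (h v ⟨hv, hp⟩) (Finset.mem_erase.1 hv).1.symm,
    fun h v hv => (h v hv.1 hv.2).le⟩

end RTree

/-! ### The numbers of rooted and of minimally rooted trees -/

/-- Listed in decreasing order, the elements of `V` have 0, 1, 2, … larger elements. -/
theorem sum_card_filter_lt {M : Type*} [AddCommMonoid M] (φ : ℕ → M) (V : Finset ℕ) :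
    ∑ r ∈ V, φ #{v ∈ V | r < v} = ∑ g ∈ range #V, φ g := by
  induction V using Finset.induction_on_min with
  | empty => simp
  | insert a s has ih =>
    have ha : a ∉ s := fun h => lt_irrefl _ (has a h)
    rw [Finset.sum_insert ha, Finset.card_insert_of_notMem ha, Finset.sum_range_succ, ← ih,
      add_comm]
    congr 1
    · refine Finset.sum_congr rfl fun r hr => ?_
      rw [Finset.filter_insert, if_neg (has r hr).not_gt]
    · rw [Finset.filter_insert, if_neg (lt_irrefl a), Finset.filter_true_of_mem has]

theorem prod_card_filter_lt {M : Type*} [CommMonoid M] (φ : ℕ → M) (V : Finset ℕ) :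
    ∏ r ∈ V, φ #{v ∈ V | r < v} = ∏ g ∈ range #V, φ g :=
  sum_card_filter_lt (M := Additive M) φ V

/-- The number of rooted trees on a set of `m` elements. -/
def treeNum (m : ℕ) : ℕ := if m = 0 then 0 else m ^ (m - 1)

/-- The number of minimally rooted trees on a set of `m` elements. -/
def minTreeNum (m : ℕ) : ℕ := if m = 0 then 0 else (m - 1) ^ (m - 1)

theorem encard_eq_sum_root (V : Finset ℕ) (P : RTree → Prop) :
    {T : RTree | T.verts = V ∧ P T}.encard =
      ∑ r ∈ V, {T : RTree | T.verts = V ∧ T.root = r ∧ P T}.encard := by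
  rw [encard_eq_sum _ V (fun r T => T.root = r)]
  · refine Finset.sum_congr rfl fun r _ => ?_
    congr 1
    ext T
    simp only [Set.mem_ofPred_eq]
    tauto
  · rintro T ⟨rfl, -⟩
    exact ⟨T.root, ⟨T.root_mem, rfl⟩, fun r h => h.2.symm⟩

theorem encard_trees (V : Finset ℕ) : {T : RTree | T.verts = V}.encard = (treeNum #V : ℕ) := by
  have h := encard_eq_sum_root V fun _ => True
  simp only [and_true] at h
  rw [h, treeNum]
  split_ifs with h0
  · simp [Finset.card_eq_zero.1 h0]
  rw [Finset.sum_congr rfl (g := fun _ => ((forestNum (#V - 1) 1 : ℕ) : ℕ∞))]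
  · rw [Finset.sum_const, nsmul_eq_mul, ← Nat.cast_mul]
    congr 1
    obtain ⟨m, hm⟩ := Nat.exists_eq_succ_of_ne_zero h0
    rw [hm, forestNum]
    rcases m with _ | m
    · simp
    · simp [pow_succ, mul_comm]
  · intro r hr
    have := RTree.encard_trees_eq hr fun _ => True
    simp only [and_true] at this
    rw [this, ← Finset.card_erase_of_mem hr]
    simpa using encard_forests_true (X := V.erase r) (R := {r}) (by simp)

theorem encard_minTrees_root {V : Finset ℕ} {r : ℕ} (hr : r ∈ V) :
    {T : RTree | T.verts = V ∧ T.root = r ∧ T.IsMinimallyRooted}.encard =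
      (forests (· < ·) (V.erase r) {r}).encard := by
  have h := RTree.encard_trees_eq hr fun p => ∀ v ∈ V.erase r, p v = r → r < v
  have h1 : {T : RTree | T.verts = V ∧ T.root = r ∧ T.IsMinimallyRooted} =
      {T : RTree | T.verts = V ∧ T.root = r ∧ ∀ v ∈ V.erase r, T.parent v = r → r < v} := by
    ext T
    simp only [Set.mem_ofPred_eq, RTree.isMinimallyRooted_iff]
    constructor <;>
    · rintro ⟨rfl, rfl, h'⟩
      exact ⟨rfl, rfl, h'⟩
  rw [h1, h]
  congr 1
  ext p
  simp only [forests, Set.mem_ofPred_eq, Finset.mem_singleton, implies_true, true_and]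
  constructor
  · rintro ⟨⟨h1, h2, h3⟩, h4⟩
    exact ⟨h1, h2, fun v hv hp => by rw [hp]; exact h4 v hv hp, h3⟩
  · rintro ⟨h1, h2, h4, h3⟩
    exact ⟨⟨h1, h2, h3⟩, fun v hv hp => by have := h4 v hv hp; rwa [hp] at this⟩

/-- The children of `r` are any `z` of the larger vertices, and they are the roots of an arbitrary
forest on the rest. The range of `z` exceeds the number of larger vertices, where the binomial
vanishes, so that it does not depend on `r`. -/
theorem encard_forests_lt_singleton {V : Finset ℕ} {r : ℕ} (hr : r ∈ V) :
    (forests (· < ·) (V.erase r) {r}).encard = ((∑ z ∈ range #V,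
      (#{v ∈ V | r < v}).choose z * forestNum (#V - 1 - z) z : ℕ) : ℕ∞) := by
  rw [encard_forests_eq_sum_layer _ (by simp)]
  have hsub : ({v ∈ V | r < v}).powerset ⊆ (V.erase r).powerset := by
    refine Finset.powerset_mono.2 fun v hv => ?_
    rw [Finset.mem_filter] at hv
    exact Finset.mem_erase.2 ⟨hv.2.ne', hv.1⟩
  rw [← Finset.sum_subset hsub]
  · have key := Finset.sum_powerset_apply_card (fun z => forestNum (#V - 1 - z) z)
      (x := {v ∈ V | r < v})
    simp only [smul_eq_mul] at key
    have hle : range (#{v ∈ V | r < v} + 1) ⊆ range #V := by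
      refine Finset.range_subset_range.2 (Finset.card_lt_card ?_)
      refine Finset.ssubset_iff_subset_ne.2 ⟨Finset.filter_subset _ _, fun h => ?_⟩
      rw [← h] at hr
      simp at hr
    rw [← Finset.sum_subset hle, ← key, Nat.cast_sum]
    · refine Finset.sum_congr rfl fun Z hZ => ?_
      rw [Finset.mem_powerset] at hZ
      have hlt : ∀ v ∈ Z, r < v := fun v hv => (Finset.mem_filter.1 (hZ hv)).2
      have h1 : ∏ v ∈ Z, #{u ∈ ({r} : Finset ℕ) | u < v} = 1 := by
        refine Finset.prod_eq_one fun v hv => ?_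
        rw [Finset.filter_singleton, if_pos (hlt v hv), Finset.card_singleton]
      rw [h1, Nat.cast_one, one_mul, encard_forests_true Finset.sdiff_disjoint,
        Finset.card_sdiff_of_subset (Finset.mem_powerset.1 (hsub (Finset.mem_powerset.2 hZ))),
        Finset.card_erase_of_mem hr]
    · intro z _ hz
      rw [Finset.mem_range, not_lt] at hz
      rw [Nat.choose_eq_zero_of_lt (by omega), zero_mul]
  · intro Z hZ hZ'
    obtain ⟨v, hv, hrv⟩ : ∃ v ∈ Z, ¬ r < v := by
      by_contra! h
      refine hZ' (Finset.mem_powerset.2 fun v hv => Finset.mem_filter.2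
        ⟨Finset.mem_of_mem_erase (Finset.mem_powerset.1 hZ hv), h v hv⟩)
    rw [Finset.prod_eq_zero hv, Nat.cast_zero, zero_mul]
    rw [Finset.filter_singleton, if_neg hrv, Finset.card_empty]

theorem sum_range_choose_succ (n z : ℕ) :
    ∑ g ∈ range n, g.choose z = n.choose (z + 1) := by
  induction n with
  | zero => simp
  | succ n ih => rw [Finset.sum_range_succ, ih, Nat.choose_succ_succ, add_comm]

/-- After multiplication by `n` the summand is C(n+1, z+1) z n^(n-z). Writing z = (z+1) - 1 gives
two binomial expansions, (n+1)^(n+1) and (n+1)^(n+1) - n^(n+1). -/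
theorem sum_choose_succ_mul_forestNum (n : ℕ) :
    ∑ z ∈ range (n + 1), (n + 1).choose (z + 1) * forestNum (n - z) z = n ^ n := by
  rcases Nat.eq_zero_or_pos n with rfl | hn
  · simp [forestNum]
  apply Nat.eq_of_mul_eq_mul_left hn
  rw [Finset.mul_sum]
  have h1 : ∀ z ∈ range (n + 1), n * ((n + 1).choose (z + 1) * forestNum (n - z) z) =
      (n + 1).choose (z + 1) * (z * n ^ (n - z)) := by
    intro z hz
    rw [← mul_forestNum (n := n) (z := z) (by simp at hz; omega)]
    ring
  rw [Finset.sum_congr rfl h1]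
  have h2 : ∑ z ∈ range (n + 1), (n + 1).choose (z + 1) * ((z + 1) * n ^ (n - z)) =
      (n + 1) ^ (n + 1) := by
    have := add_pow 1 n n
    rw [add_comm 1 n] at this
    rw [pow_succ', this, Finset.mul_sum]
    refine Finset.sum_congr rfl fun z _ => ?_
    have := Nat.add_one_mul_choose_eq n z
    calc _ = ((n + 1).choose (z + 1) * (z + 1)) * n ^ (n - z) := by ring
      _ = _ := by rw [← this, Nat.cast_id]; ring
  have h3 : ∑ z ∈ range (n + 1), (n + 1).choose (z + 1) * n ^ (n - z) + n ^ (n + 1) =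
      (n + 1) ^ (n + 1) := by
    have := add_pow 1 n (n + 1)
    rw [add_comm 1 n] at this
    rw [this, Finset.sum_range_succ' _ (n + 1)]
    simp [add_comm, mul_comm]
  have h4 : ∑ z ∈ range (n + 1), (n + 1).choose (z + 1) * ((z + 1) * n ^ (n - z)) =
      ∑ z ∈ range (n + 1), (n + 1).choose (z + 1) * (z * n ^ (n - z)) +
      ∑ z ∈ range (n + 1), (n + 1).choose (z + 1) * n ^ (n - z) := by
    rw [← Finset.sum_add_distrib]
    exact Finset.sum_congr rfl fun z _ => by ring
  rw [← pow_succ']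
  omega

/-- Summing over the root turns the binomials C(g, z), with g the number of vertices above the root,
into C(|V|, z+1). -/
theorem encard_minTrees (V : Finset ℕ) :
    {T : RTree | T.verts = V ∧ T.IsMinimallyRooted}.encard = (minTreeNum #V : ℕ) := by
  rw [encard_eq_sum_root, minTreeNum]
  split_ifs with h0
  · simp [Finset.card_eq_zero.1 h0]
  rw [Finset.sum_congr rfl fun r hr =>
    (encard_minTrees_root hr).trans (encard_forests_lt_singleton hr), ← Nat.cast_sum,
    sum_card_filter_lt (fun g => ∑ z ∈ range #V, g.choose z * forestNum (#V - 1 - z) z) V,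
    Finset.sum_comm]
  obtain ⟨m, hm⟩ := Nat.exists_eq_succ_of_ne_zero h0
  rw [hm]
  simp only [← Finset.sum_mul, sum_range_choose_succ, Nat.succ_eq_add_one, Nat.add_sub_cancel,
    sum_choose_succ_mul_forestNum]

/-! ### Identities between exponential generating functions -/

open PowerSeries in
/-- The number of structures on `n` points encoded by the exponential generating function `F`. -/
noncomputable def egfCount (F : ℚ⟦X⟧) (n : ℕ) : ℚ := n.factorial * coeff n F

/-- The exponential generating function of a sequence. -/
noncomputable def egf (a : ℕ → ℚ) : PowerSeries ℚ := PowerSeries.mk fun n => a n / n.factorial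

theorem egfCount_egf (a : ℕ → ℚ) (n : ℕ) : egfCount (egf a) n = a n := by
  have : (n.factorial : ℚ) ≠ 0 := by exact_mod_cast n.factorial_ne_zero
  rw [egfCount, egf, PowerSeries.coeff_mk]
  field_simp

/-- The product rule is stated as a sum over subsets because the structures are split by the vertex
set of their first tree. -/
theorem egfCount_mul (F G : PowerSeries ℚ) (X : Finset ℕ) :
    egfCount (F * G) #X = ∑ V ∈ X.powerset, egfCount F #V * egfCount G #(X \ V) := by
  have h1 : ∀ V ∈ X.powerset, egfCount F #V * egfCount G #(X \ V) =
      (fun m => egfCount F m * egfCount G (#X - m)) #V := by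
    intro V hV
    rw [Finset.card_sdiff_of_subset (Finset.mem_powerset.1 hV)]
  rw [Finset.sum_congr rfl h1,
    Finset.sum_powerset_apply_card (fun m => egfCount F m * egfCount G (#X - m)), egfCount,
    PowerSeries.coeff_mul,
    Finset.Nat.sum_antidiagonal_eq_sum_range_succ_mk, Finset.mul_sum]
  refine Finset.sum_congr rfl fun m hm => ?_
  have hm' : m ≤ #X := by simp at hm; omega
  rw [nsmul_eq_mul, egfCount, egfCount, ← Nat.choose_mul_factorial_mul_factorial hm']
  push_cast
  ring

theorem egf_ext {F G : PowerSeries ℚ} (h : ∀ n, egfCount F n = egfCount G n) : F = G := by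
  ext n
  have hn : (n.factorial : ℚ) ≠ 0 := by exact_mod_cast n.factorial_ne_zero
  exact mul_left_cancel₀ hn (h n)

theorem egfCount_derivative (F : PowerSeries ℚ) (n : ℕ) :
    egfCount (PowerSeries.derivative ℚ F) n = egfCount F (n + 1) := by
  rw [egfCount, egfCount, PowerSeries.coeff_derivative, Nat.factorial_succ]
  push_cast
  ring

theorem egfCount_X_mul (F : PowerSeries ℚ) (n : ℕ) :
    egfCount (PowerSeries.X * F) (n + 1) = (n + 1) * egfCount F n := by
  rw [egfCount, egfCount, PowerSeries.coeff_succ_X_mul, Nat.factorial_succ]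
  push_cast
  ring

theorem egfCount_X_mul_zero (F : PowerSeries ℚ) : egfCount (PowerSeries.X * F) 0 = 0 := by
  simp [egfCount]

theorem egfCount_add (F G : PowerSeries ℚ) (n : ℕ) :
    egfCount (F + G) n = egfCount F n + egfCount G n := by
  rw [egfCount, map_add, mul_add]; rfl

theorem egfCount_sub (F G : PowerSeries ℚ) (n : ℕ) :
    egfCount (F - G) n = egfCount F n - egfCount G n := by
  rw [egfCount, map_sub, mul_sub]; rfl

theorem egfCount_one (n : ℕ) : egfCount 1 n = if n = 0 then 1 else 0 := by
  rw [egfCount, PowerSeries.coeff_one]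
  split_ifs with h <;> simp [h]

theorem egfCount_natCast_mul (F : PowerSeries ℚ) (a n : ℕ) :
    egfCount (a * F) n = a * egfCount F n := by
  have : (a : PowerSeries ℚ) = PowerSeries.C (a : ℚ) := by simp
  rw [egfCount, this, PowerSeries.coeff_C_mul, egfCount]
  ring

/-- The generating function of rooted trees. -/
noncomputable def treeSeries : PowerSeries ℚ := egf fun n => treeNum n

/-- The generating function of minimally rooted trees. -/
noncomputable def minTreeSeries : PowerSeries ℚ := egf fun n => minTreeNum n

/-- The generating function of forests with a single given root. -/
noncomputable def forestSeries : PowerSeries ℚ := egf fun n => forestNum n 1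

/-- The generating function of maps from `n` points to `n + a` points. -/
noncomputable def mapSeries (a : ℕ) : PowerSeries ℚ := egf fun n => (n + a : ℚ) ^ n

/-- A forest with b+1 given roots is the tree at one of them and a forest at the others. The
intervals merely provide disjoint labels for `encard_forests_insert`. -/
theorem forestNum_succ (n b : ℕ) : (forestNum n (b + 1) : ℚ) =
    egfCount (forestSeries * egf fun n => forestNum n b) n := by
  have h := encard_forests_insert (fun _ _ => True) (X := range n) (R := Ico (n + 1) (n + 1 + b))
    (r := n) (Finset.disjoint_left.2 fun v hv => by simp at hv ⊢; omega) (by simp) (by simp)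
  have h1 := Finset.card_insert_of_notMem (a := n) (s := Ico (n + 1) (n + 1 + b)) (by simp)
  rw [encard_forests_true (Finset.disjoint_left.2 fun v hv => by simp at hv ⊢; omega), h1,
    Finset.sum_congr rfl (g := fun V => ((forestNum #V 1 * forestNum #(range n \ V) b : ℕ) : ℕ∞)),
    ← Nat.cast_sum, Nat.cast_inj, Nat.card_Ico, Finset.card_range, Nat.add_sub_cancel_left] at h
  · rw [h]
    have := egfCount_mul forestSeries (egf fun n => forestNum n b) (range n)
    rw [Finset.card_range] at this
    rw [this, Nat.cast_sum]
    exact Finset.sum_congr rfl fun V _ => by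
      rw [forestSeries, egfCount_egf, egfCount_egf, Nat.cast_mul]
  · intro V hV
    rw [Finset.mem_powerset] at hV
    rw [encard_forests_true, encard_forests_true, Nat.card_Ico, Nat.add_sub_cancel_left,
      Finset.card_singleton, Nat.cast_mul]
    · exact Finset.disjoint_left.2 fun v hv => by simp at hv ⊢; omega
    · exact Finset.disjoint_left.2 fun v hv => by have := hV hv; simp at this ⊢; omega

theorem egf_forestNum_two : (egf fun n => forestNum n 2) = forestSeries * forestSeries :=
  egf_ext fun n => by rw [egfCount_egf]; exact forestNum_succ n 1

theorem mapSeries_zero_eq : mapSeries 0 = 1 + PowerSeries.X * mapSeries 1 := by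
  refine egf_ext fun n => ?_
  rw [egfCount_add, egfCount_one, mapSeries, egfCount_egf]
  rcases n with _ | n
  · simp [egfCount_X_mul_zero]
  · rw [egfCount_X_mul, mapSeries, egfCount_egf]
    simp only [Nat.add_eq_zero_iff, one_ne_zero, and_false, if_false]
    push_cast
    ring

theorem mapSeries_one_eq : mapSeries 1 = forestSeries + PowerSeries.X * mapSeries 2 := by
  refine egf_ext fun n => ?_
  rw [egfCount_add, forestSeries, mapSeries, egfCount_egf, egfCount_egf]
  rcases n with _ | n
  · simp [egfCount_X_mul_zero, forestNum]
  · rw [egfCount_X_mul, mapSeries, egfCount_egf, forestNum]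
    simp only [Nat.add_eq_zero_iff, one_ne_zero, and_false, if_false, Nat.add_sub_cancel]
    push_cast
    ring

/-- With F the forest series and W_a the map series, comparing coefficients gives W_1 = F + x F'.
Doing the same for two roots, whose series is F², gives 2 W_2 = 2 F² + x (F²)' = 2 F W_1. -/
theorem mapSeries_two_eq : mapSeries 2 = forestSeries * mapSeries 1 := by
  have h1 : mapSeries 1 = forestSeries + PowerSeries.X * PowerSeries.derivative ℚ forestSeries := by
    refine egf_ext fun n => ?_
    rw [egfCount_add, forestSeries, mapSeries, egfCount_egf, egfCount_egf]
    rcases n with _ | n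
    · simp [egfCount_X_mul_zero, forestNum]
    · rw [egfCount_X_mul, egfCount_derivative, egfCount_egf, forestNum]
      simp only [Nat.add_eq_zero_iff, one_ne_zero, and_false, if_false, Nat.add_sub_cancel]
      push_cast
      ring
  have h2 : ((2 : ℕ) : PowerSeries ℚ) * mapSeries 2 =
      ((2 : ℕ) : PowerSeries ℚ) * (forestSeries * forestSeries) +
      PowerSeries.X * PowerSeries.derivative ℚ (forestSeries * forestSeries) := by
    rw [← egf_forestNum_two]
    refine egf_ext fun n => ?_
    rw [egfCount_add, egfCount_natCast_mul, egfCount_natCast_mul, mapSeries, egfCount_egf,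
      egfCount_egf]
    rcases n with _ | n
    · simp [egfCount_X_mul_zero, forestNum]
    · rw [egfCount_X_mul, egfCount_derivative, egfCount_egf, forestNum]
      simp only [Nat.add_eq_zero_iff, one_ne_zero, and_false, if_false, Nat.add_sub_cancel]
      push_cast
      ring
  have h3 : ((2 : ℕ) : PowerSeries ℚ) ≠ 0 := by
    rw [← map_natCast PowerSeries.C 2]
    exact (map_ne_zero_iff _ PowerSeries.C_injective).2 (by norm_num)
  refine mul_left_cancel₀ h3 ?_
  rw [h2, h1, Derivation.leibniz, smul_eq_mul]
  push_cast
  ring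

theorem derivative_forestSeries :
    PowerSeries.derivative ℚ forestSeries = mapSeries 2 := by
  refine egf_ext fun n => ?_
  rw [egfCount_derivative, forestSeries, mapSeries, egfCount_egf, egfCount_egf, forestNum]
  simp only [Nat.add_eq_zero_iff, one_ne_zero, and_false, if_false, Nat.add_sub_cancel]
  push_cast
  ring

theorem mapSeries_one_eq_mul : mapSeries 1 = forestSeries * mapSeries 0 := by
  conv_lhs => rw [mapSeries_one_eq, mapSeries_two_eq]
  rw [mapSeries_zero_eq]
  ring

theorem treeSeries_eq : treeSeries = PowerSeries.X * forestSeries := by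
  refine egf_ext fun n => ?_
  rw [treeSeries, egfCount_egf, treeNum]
  rcases n with _ | n
  · simp [egfCount_X_mul_zero]
  · rw [egfCount_X_mul, forestSeries, egfCount_egf, forestNum]
    rcases n with _ | n
    · simp
    · simp only [Nat.add_eq_zero_iff, one_ne_zero, and_false, if_false, Nat.add_sub_cancel]
      push_cast
      ring

theorem one_sub_treeSeries_mul : (1 - treeSeries) * mapSeries 0 = 1 := by
  have h1 := mapSeries_one_eq
  rw [mapSeries_two_eq] at h1
  rw [treeSeries_eq, mapSeries_zero_eq]
  linear_combination PowerSeries.X * h1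

theorem derivative_minTreeSeries :
    PowerSeries.derivative ℚ minTreeSeries = mapSeries 0 := by
  refine egf_ext fun n => ?_
  rw [egfCount_derivative, minTreeSeries, mapSeries, egfCount_egf, egfCount_egf, minTreeNum]
  simp

/-- Uniqueness for a linear differential equation: each coefficient of `W` is determined by the
preceding ones. -/
theorem eq_zero_of_derivative_eq_mul {W A : PowerSeries ℚ}
    (h : PowerSeries.derivative ℚ W = A * W) (h0 : PowerSeries.coeff 0 W = 0) : W = 0 := by
  ext n
  rw [map_zero]
  induction n using Nat.strong_induction_on with
  | _ n ih =>
  rcases n with _ | n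
  · exact h0
  · have := congrArg (PowerSeries.coeff n) h
    rw [PowerSeries.coeff_derivative, PowerSeries.coeff_mul, Finset.sum_eq_zero] at this
    · have hn : ((n : ℚ) + 1) ≠ 0 := by positivity
      exact (mul_eq_zero.1 this).resolve_right hn
    · intro x hx
      have := Finset.HasAntidiagonal.mem_antidiagonal.1 hx
      rw [ih x.2 (by omega), mul_zero]

theorem coeff_zero_forestSeries : PowerSeries.coeff 0 forestSeries = 1 := by
  simp [forestSeries, egf, forestNum]

theorem coeff_zero_minTreeSeries : PowerSeries.coeff 0 minTreeSeries = 0 := by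
  simp [minTreeSeries, egf, minTreeNum]

/-- In the notation F, M, W, one has F' = F² W and M' = W. Hence y = F (1 - M) - 1 satisfies y' = F
W y and has constant term 0. -/
theorem forestSeries_mul_one_sub : forestSeries * (1 - minTreeSeries) = 1 := by
  have hD : PowerSeries.derivative ℚ (forestSeries * (1 - minTreeSeries) - 1) =
      (forestSeries * mapSeries 0) * (forestSeries * (1 - minTreeSeries) - 1) := by
    rw [map_sub, Derivation.leibniz, smul_eq_mul, smul_eq_mul, map_sub, derivative_forestSeries,
      derivative_minTreeSeries, mapSeries_two_eq, mapSeries_one_eq_mul, Derivation.map_one_eq_zero]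
    ring
  refine sub_eq_zero.1 (eq_zero_of_derivative_eq_mul hD ?_)
  have h1 := coeff_zero_forestSeries
  have h2 := coeff_zero_minTreeSeries
  rw [PowerSeries.coeff_zero_eq_constantCoeff_apply] at h1 h2 ⊢
  simp [h1, h2]

/-- Put V = 1 - M. Then V^(a+1) W = V^(a+1) + x V^a W and (V^(a+1))' = -(a+1) V^a W. By induction
the coefficient at n+1 is (n+1 - (a+1)) (n-a)^n, which is the claimed power. -/
theorem egfCount_one_sub_pow_mul (a n : ℕ) :
    egfCount ((1 - minTreeSeries) ^ a * mapSeries 0) n = ((n : ℚ) - a) ^ n := by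
  induction a generalizing n with
  | zero => rw [pow_zero, one_mul, mapSeries, egfCount_egf]; simp
  | succ a ih =>
    set V := 1 - minTreeSeries with hV
    have hX : V ^ (a + 1) * mapSeries 0 =
        V ^ (a + 1) + PowerSeries.X * (V ^ a * mapSeries 0) := by
      conv_lhs => rw [mapSeries_zero_eq, mapSeries_one_eq_mul]
      linear_combination PowerSeries.X * V ^ a * mapSeries 0 * forestSeries_mul_one_sub
    have hd : PowerSeries.derivative ℚ (V ^ (a + 1)) =
        -(((a + 1 : ℕ) : PowerSeries ℚ) * (V ^ a * mapSeries 0)) := by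
      rw [Derivation.leibniz_pow, hV, map_sub, derivative_minTreeSeries,
        Derivation.map_one_eq_zero, smul_eq_mul, nsmul_eq_mul, Nat.add_sub_cancel]
      ring
    rw [hX, egfCount_add]
    rcases n with _ | n
    · rw [egfCount_X_mul_zero, egfCount]
      have h2 := coeff_zero_minTreeSeries
      rw [PowerSeries.coeff_zero_eq_constantCoeff_apply] at h2 ⊢
      simp [hV, h2]
    · rw [egfCount_X_mul, ih, ← egfCount_derivative, hd, ← zero_sub, egfCount_sub,
        egfCount_natCast_mul, ih]
      have : egfCount 0 n = 0 := by simp [egfCount]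
      rw [this]
      push_cast
      ring

/-! ### The common number and its recursions -/

/-- The common cardinality: the number of maps `[n] → [n]` whose image contains `k` given points. -/
noncomputable def commonNum (n k : ℕ) : ℚ := egfCount (minTreeSeries ^ k * mapSeries 0) n

theorem egfCount_minTreeSeries_pow_succ (n k : ℕ) :
    egfCount (minTreeSeries ^ (k + 1)) (n + 1) = (k + 1) * commonNum n k := by
  rw [← egfCount_derivative, Derivation.leibniz_pow, derivative_minTreeSeries, smul_eq_mul,
    nsmul_eq_mul, egfCount_natCast_mul, Nat.add_sub_cancel, commonNum]
  push_cast
  rfl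

theorem commonNum_succ_eq_sum (X : Finset ℕ) (k : ℕ) :
    commonNum #X (k + 1) = ∑ V ∈ X.powerset, (minTreeNum #V : ℚ) * commonNum #(X \ V) k := by
  rw [commonNum, pow_succ', mul_assoc, egfCount_mul]
  exact Finset.sum_congr rfl fun V _ => by rw [commonNum, minTreeSeries, egfCount_egf]

/-- This is 1/(1 - T) = 1 + T/(1 - T), multiplied by M^k. -/
theorem commonNum_eq_add (X : Finset ℕ) (k : ℕ) :
    commonNum #X k = egfCount (minTreeSeries ^ k) #X +
      ∑ V ∈ X.powerset, (treeNum #V : ℚ) * commonNum #(X \ V) k := by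
  have h : minTreeSeries ^ k * mapSeries 0 =
      minTreeSeries ^ k + treeSeries * (minTreeSeries ^ k * mapSeries 0) := by
    linear_combination minTreeSeries ^ k * one_sub_treeSeries_mul
  rw [commonNum, h, egfCount_add, egfCount_mul]
  congr 1
  exact Finset.sum_congr rfl fun V _ => by
    rw [commonNum, show egfCount treeSeries #V = treeNum #V from egfCount_egf _ _]

/-- A count of structures with a set `K` of hit points and a set `S` of missed points is determined
by inclusion–exclusion. -/
theorem eq_egfCount_of_recurrence {n : ℕ} (U : Finset ℕ) (Φ : Finset ℕ → Finset ℕ → ℚ)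
    (h0 : ∀ S ⊆ U, Φ ∅ S = ((n : ℚ) - #S) ^ n)
    (h1 : ∀ K S s, s ∈ U → s ∉ K → s ∉ S → Φ (insert s K) S + Φ K (insert s S) = Φ K S)
    {K S : Finset ℕ} (hK : K ⊆ U) (hS : S ⊆ U) (hKS : Disjoint K S) :
    Φ K S = egfCount (minTreeSeries ^ #K * ((1 - minTreeSeries) ^ #S * mapSeries 0)) n := by
  induction K using Finset.induction_on generalizing S with
  | empty => rw [h0 S hS, Finset.card_empty, pow_zero, one_mul, egfCount_one_sub_pow_mul]
  | insert s K hs ih =>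
    rw [Finset.insert_subset_iff] at hK
    rw [Finset.disjoint_insert_left] at hKS
    have e1 := h1 K S s hK.1 hs hKS.1
    rw [ih hK.2 hS hKS.2, ih hK.2 (Finset.insert_subset hK.1 hS)
      (Finset.disjoint_insert_right.2 ⟨hs, hKS.2⟩), Finset.card_insert_of_notMem hKS.1] at e1
    -- Hitting `s` is the total minus missing `s`, which on series replaces 1 by 1 - (1 - M) = M.
    rw [eq_sub_of_add_eq e1, ← egfCount_sub, Finset.card_insert_of_notMem hs]
    congr 1
    ring

/-! ### Cardinalities with rational values -/

/-- The set `s` is finite and has `q` elements. -/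
def CountIs {α : Type*} (s : Set α) (q : ℚ) : Prop := ∃ N : ℕ, s.encard = N ∧ (N : ℚ) = q

namespace CountIs

variable {α β : Type*} {s t : Set α} {q q' : ℚ}

theorem of_encard {N : ℕ} (h : s.encard = N) : CountIs s N := ⟨N, h, rfl⟩

theorem congr_encard {t : Set β} (hs : CountIs s q) (h : t.encard = s.encard) : CountIs t q := by
  obtain ⟨N, hN, hq⟩ := hs
  exact ⟨N, h.trans hN, hq⟩

theorem image (hs : CountIs s q) {f : α → β} (hf : Set.InjOn f s) : CountIs (f '' s) q :=
  hs.congr_encard hf.encard_image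

theorem union (hs : CountIs s q) (ht : CountIs t q') (hd : Disjoint s t) :
    CountIs (s ∪ t) (q + q') := by
  obtain ⟨N, hN, rfl⟩ := hs
  obtain ⟨M, hM, rfl⟩ := ht
  exact ⟨N + M, by rw [Set.encard_union_eq hd, hN, hM]; norm_cast, by push_cast; rfl⟩

theorem empty : CountIs (∅ : Set α) 0 := ⟨0, by simp, by simp⟩

theorem singleton (a : α) : CountIs {a} 1 := ⟨1, by simp, by simp⟩

theorem finite (hs : CountIs s q) : s.Finite := by
  obtain ⟨N, hN, -⟩ := hs
  exact Set.finite_of_encard_eq_coe hN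

theorem sum {ι : Type*} (I : Finset ι) (Q : ι → α → Prop) (w : ι → ℚ)
    (h : ∀ a ∈ s, ∃! i, i ∈ I ∧ Q i a) (hw : ∀ i ∈ I, CountIs {a ∈ s | Q i a} (w i)) :
    CountIs s (∑ i ∈ I, w i) := by
  choose! N hN hq using hw
  refine ⟨∑ i ∈ I, N i, ?_, ?_⟩
  · rw [encard_eq_sum s I Q h, Nat.cast_sum]
    exact Finset.sum_congr rfl fun i hi => hN i hi
  · rw [Nat.cast_sum]
    exact Finset.sum_congr rfl fun i hi => hq i hi

theorem prod {t : Set β} (hs : CountIs s q) (ht : CountIs t q') : CountIs (s ×ˢ t) (q * q') := by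
  obtain ⟨N, hN, rfl⟩ := hs
  obtain ⟨M, hM, rfl⟩ := ht
  exact ⟨N * M, by rw [encard_prod_eq, hN, hM]; norm_cast, by push_cast; rfl⟩

theorem nonempty_equiv {t : Set β} (hs : CountIs s q) (ht : CountIs t q) : Nonempty (s ≃ t) := by
  obtain ⟨N, hN, rfl⟩ := hs
  obtain ⟨M, hM, h⟩ := ht
  have : M = N := by exact_mod_cast h
  subst this
  have := (Set.finite_of_encard_eq_coe hN).to_subtype
  have := (Set.finite_of_encard_eq_coe hM).to_subtype
  refine Finite.card_eq.1 ?_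
  rw [Nat.card_coe_set_eq, Nat.card_coe_set_eq, Set.ncard, Set.ncard, hN, hM]

end CountIs

theorem countIs_trees (V : Finset ℕ) : CountIs {T : RTree | T.verts = V} (treeNum #V) :=
  .of_encard (encard_trees V)

theorem countIs_minTrees (V : Finset ℕ) :
    CountIs {T : RTree | T.verts = V ∧ T.IsMinimallyRooted} (minTreeNum #V) :=
  .of_encard (encard_minTrees V)

/-- Counting pairs of a tree in `X` and a structure that depends on the vertex set of the tree. -/
theorem countIs_pairs {α : Type*} {P : RTree → Prop} {t b : Finset ℕ → ℚ} {X : Finset ℕ}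
    {B : Finset ℕ → Set α} (ht : ∀ V, CountIs {T : RTree | T.verts = V ∧ P T} (t V))
    (hb : ∀ V ⊆ X, V.Nonempty → CountIs (B V) (b V)) :
    CountIs {x : RTree × α | P x.1 ∧ x.1.verts ⊆ X ∧ x.2 ∈ B x.1.verts}
      (∑ V ∈ X.powerset, t V * b V) := by
  refine CountIs.sum X.powerset (fun V x => x.1.verts = V) _ ?_ ?_
  · rintro ⟨T, x⟩ ⟨-, h, -⟩
    exact ⟨T.verts, ⟨Finset.mem_powerset.2 h, rfl⟩, fun V hV => hV.2.symm⟩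
  · intro V hV
    rw [Finset.mem_powerset] at hV
    rcases V.eq_empty_or_nonempty with rfl | hne
    · have h0 : {T : RTree | T.verts = ∅ ∧ P T} = ∅ := by
        ext T
        simp only [Set.mem_ofPred_eq, Set.mem_empty_iff_false, iff_false, not_and]
        intro h
        have := T.root_mem
        simp [h] at this
      have ht0 : t ∅ = 0 := by
        obtain ⟨N, hN, h⟩ := ht ∅
        rw [h0, Set.encard_empty] at hN
        rw [← h]
        exact_mod_cast hN.symm
      rw [ht0, zero_mul]
      convert CountIs.empty
      ext ⟨T, x⟩
      simp only [Set.mem_ofPred_eq, Set.mem_empty_iff_false, iff_false, not_and]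
      intro _ h
      have := T.root_mem
      simp [h] at this
    · convert (ht V).prod (hb V hV hne)
      ext ⟨T, x⟩
      simp only [Set.mem_ofPred_eq, Set.mem_prod]
      constructor
      · rintro ⟨⟨h1, h2, h3⟩, rfl⟩
        exact ⟨⟨rfl, h1⟩, h3⟩
      · rintro ⟨⟨rfl, h1⟩, h3⟩
        exact ⟨⟨h1, hV, h3⟩, rfl⟩

/-! ### Ordered forests and cycles of trees -/

@[simp] theorem vertsOf_nil : vertsOf [] = ∅ := rfl

@[simp] theorem vertsOf_cons (T : RTree) (F : List RTree) :
    vertsOf (T :: F) = T.verts ∪ vertsOf F := rfl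

theorem mem_vertsOf {F : List RTree} {v : ℕ} : v ∈ vertsOf F ↔ ∃ T ∈ F, v ∈ T.verts := by
  induction F with
  | nil => simp
  | cons T F ih => simp [ih]

theorem isOrderedForest_cons {T : RTree} {F : List RTree} :
    IsOrderedForest (T :: F) ↔ Disjoint T.verts (vertsOf F) ∧ IsOrderedForest F := by
  rw [IsOrderedForest, List.pairwise_cons, IsOrderedForest]
  refine and_congr_left fun _ => ?_
  simp only [Finset.disjoint_left, mem_vertsOf]
  constructor
  · rintro h v hv ⟨S, hS, hvS⟩
    exact h S hS hv hvS
  · exact fun h S hS v hv hvS => h hv ⟨S, hS, hvS⟩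

theorem isOrderedForestOn_nil {X : Finset ℕ} : IsOrderedForestOn [] X ↔ X = ∅ := by
  simp [IsOrderedForestOn, IsOrderedForest, eq_comm]

theorem union_eq_iff_of_disjoint {A B X : Finset ℕ} (h : Disjoint A B) :
    A ∪ B = X ↔ A ⊆ X ∧ B = X \ A := by
  constructor
  · rintro rfl
    exact ⟨Finset.subset_union_left, (Finset.union_sdiff_cancel_left h).symm⟩
  · rintro ⟨h1, rfl⟩
    exact Finset.union_sdiff_of_subset h1

theorem isOrderedForestOn_cons {T : RTree} {F : List RTree} {X : Finset ℕ} :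
    IsOrderedForestOn (T :: F) X ↔ T.verts ⊆ X ∧ IsOrderedForestOn F (X \ T.verts) := by
  rw [IsOrderedForestOn, isOrderedForest_cons, vertsOf_cons, IsOrderedForestOn]
  constructor
  · rintro ⟨⟨h1, h2⟩, h3⟩
    rw [union_eq_iff_of_disjoint h1] at h3
    exact ⟨h3.1, h2, h3.2⟩
  · rintro ⟨h1, h2, h3⟩
    have hd : Disjoint T.verts (vertsOf F) := h3 ▸ Finset.disjoint_sdiff
    exact ⟨⟨hd, h2⟩, (union_eq_iff_of_disjoint hd).2 ⟨h1, h3⟩⟩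

/-- Ordered forests on `X` of `j` minimally rooted trees. -/
def minLists (j : ℕ) (X : Finset ℕ) : Set (List RTree) :=
  {F | F.length = j ∧ (∀ T ∈ F, T.IsMinimallyRooted) ∧ IsOrderedForestOn F X}

theorem cons_injective : Function.Injective fun x : RTree × List RTree => x.1 :: x.2 := by
  rintro ⟨T, F⟩ ⟨S, G⟩ h
  simpa using h

theorem countIs_minLists (j : ℕ) (X : Finset ℕ) :
    CountIs (minLists j X) (egfCount (minTreeSeries ^ j) #X) := by
  induction j generalizing X with
  | zero =>
    rw [pow_zero, egfCount_one]
    split_ifs with h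
    · convert CountIs.singleton ([] : List RTree)
      ext F
      simp only [minLists, Set.mem_ofPred_eq, List.length_eq_zero_iff, Set.mem_singleton_iff,
        and_iff_left_iff_imp]
      rintro rfl
      simpa [isOrderedForestOn_nil] using h
    · convert CountIs.empty
      ext F
      simp only [minLists, Set.mem_ofPred_eq, List.length_eq_zero_iff, Set.mem_empty_iff_false,
        iff_false]
      rintro ⟨rfl, -, h'⟩
      rw [isOrderedForestOn_nil] at h'
      simp [h'] at h
  | succ j ih =>
    have := (countIs_pairs (P := RTree.IsMinimallyRooted) (X := X)
      (t := fun V => (minTreeNum #V : ℚ)) countIs_minTrees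
      (B := fun V => minLists j (X \ V)) fun V _ _ => ih (X \ V)).image (cons_injective.injOn)
    rw [pow_succ', egfCount_mul]
    convert this using 1
    · ext F
      rcases F with _ | ⟨T, F⟩
      · simp [minLists]
      · simp only [minLists, Set.mem_ofPred_eq, isOrderedForestOn_cons, List.length_cons,
          Nat.add_right_cancel_iff, List.forall_mem_cons, Set.mem_image, Prod.exists,
          List.cons.injEq]
        constructor
        · rintro ⟨h1, ⟨h2, h3⟩, h4, h5⟩
          exact ⟨T, F, ⟨h2, h4, h1, h3, h5⟩, rfl, rfl⟩
        · rintro ⟨T, F, ⟨h2, h4, h1, h3, h5⟩, rfl, rfl⟩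
          exact ⟨h1, ⟨h2, h3⟩, h4, h5⟩
    · exact Finset.sum_congr rfl fun V _ => by
        rw [show egfCount minTreeSeries #V = minTreeNum #V from egfCount_egf _ _]

/-- Ordered forests on `X` whose last `k` trees exist and are minimally rooted. -/
def tailMinLists (k : ℕ) (X : Finset ℕ) : Set (List RTree) :=
  {F | IsOrderedForestOn F X ∧
    ∃ A Y : List RTree, F = A ++ Y ∧ Y.length = k ∧ ∀ T ∈ Y, T.IsMinimallyRooted}

/-- Either there are exactly `k` trees, or an arbitrary first tree can be removed: the two terms of
`commonNum_eq_add`. -/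
theorem countIs_tailMinLists (k : ℕ) (X : Finset ℕ) :
    CountIs (tailMinLists k X) (commonNum #X k) := by
  induction hn : #X using Nat.strong_induction_on generalizing X with
  | _ n ih =>
  have h1 := countIs_minLists k X
  have h2 := (countIs_pairs (P := fun _ => True) (X := X) (t := fun V => (treeNum #V : ℚ))
      (fun V => by simpa using countIs_trees V)
      (B := fun V => tailMinLists k (X \ V)) (b := fun V => commonNum #(X \ V) k)
      fun V hV hne => by
        refine ih #(X \ V) ?_ (X \ V) rfl
        have h1 := Finset.card_sdiff_of_subset hV
        have h2 := hne.card_pos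
        have h3 := Finset.card_le_card hV
        omega).image cons_injective.injOn
  rw [← hn, commonNum_eq_add]
  convert h1.union h2 ?_ using 1
  · ext F
    simp only [Set.mem_union, Set.mem_image, Set.mem_ofPred_eq, true_and, Prod.exists]
    constructor
    · rintro ⟨h, A, Y, rfl, hY, hm⟩
      rcases A with _ | ⟨T, A⟩
      · exact Or.inl ⟨hY, hm, h⟩
      · rw [List.cons_append, isOrderedForestOn_cons] at h
        exact Or.inr ⟨T, A ++ Y, ⟨h.1, h.2, A, Y, rfl, hY, hm⟩, rfl⟩
    · rintro (⟨hY, hm, h⟩ | ⟨T, F, ⟨hT, h, A, Y, rfl, hY, hm⟩, rfl⟩)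
      · exact ⟨h, [], F, rfl, hY, hm⟩
      · exact ⟨isOrderedForestOn_cons.2 ⟨hT, h⟩, T :: A, Y, rfl, hY, hm⟩
  · refine Set.disjoint_left.2 ?_
    rintro _ ⟨hl, -⟩ ⟨⟨T, F⟩, ⟨-, -, -, A, Y, h, hY, -⟩, rfl⟩
    dsimp only at h
    subst h
    simp at hl
    omega

theorem isOrderedForestOn_perm {F G : List RTree} (h : F.Perm G) {X : Finset ℕ}
    (hF : IsOrderedForestOn F X) : IsOrderedForestOn G X := by
  refine ⟨(h.pairwise_iff fun {S T} h => h.symm).1 hF.1, ?_⟩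
  rw [← hF.2]
  ext v
  simp only [mem_vertsOf, h.mem_iff]

theorem IsOrderedForest.nodup {F : List RTree} (h : IsOrderedForest F) : F.Nodup := by
  refine List.Pairwise.imp (fun {S T} hd => ?_) h
  rintro rfl
  exact Finset.disjoint_left.1 hd S.root_mem S.root_mem

/-- The trees are distinct because their vertex sets are disjoint and nonempty, so each cycle has
exactly k+1 linear representatives. The factor k+1 cancels the one from differentiating M^(k+1). -/
theorem countIs_setA (n k : ℕ) : CountIs (setA n k) (commonNum n k) := by
  classical
  set X := Finset.Icc 1 (n + 1) with hX
  obtain ⟨N, hN, hq⟩ := countIs_minLists (k + 1) X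
  have himg : setA n k = (fun F : List RTree => (F : Cycle RTree)) '' minLists (k + 1) X := by
    ext c
    simp only [setA, minLists, Set.mem_ofPred_eq, Set.mem_image, ← hX]
    constructor
    · rintro ⟨F, h, h'⟩
      exact ⟨F, h', h⟩
    · rintro ⟨F, h', h⟩
      exact ⟨F, h, h'⟩
  have hfin : (setA n k).Finite := himg ▸ (Set.finite_of_encard_eq_coe hN).image _
  have hsum : (minLists (k + 1) X).encard = ∑ c ∈ hfin.toFinset, ((k + 1 : ℕ) : ℕ∞) := by
    rw [encard_eq_sum _ hfin.toFinset (fun c (F : List RTree) => (F : Cycle RTree) = c)]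
    · refine Finset.sum_congr rfl fun c hc => ?_
      rw [Set.Finite.mem_toFinset, himg] at hc
      obtain ⟨F, ⟨h1, h2, h3⟩, rfl⟩ := hc
      have hset : {G | G ∈ minLists (k + 1) X ∧ (G : Cycle RTree) = (F : Cycle RTree)} =
          (F.cyclicPermutations.toFinset : Set (List RTree)) := by
        ext G
        simp only [Set.mem_ofPred_eq, Cycle.coe_eq_coe, List.coe_toFinset,
          List.mem_cyclicPermutations_iff, and_iff_right_iff_imp]
        intro hr
        have hp := hr.perm
        exact ⟨hp.length_eq.trans h1, fun T hT => h2 T (hp.mem_iff.1 hT),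
          isOrderedForestOn_perm hp.symm h3⟩
      rw [hset, Set.encard_coe_eq_coe_finsetCard,
        List.toFinset_card_of_nodup h3.1.nodup.cyclicPermutations,
        List.length_cyclicPermutations_of_ne_nil, h1]
      rintro rfl
      simp at h1
    · intro F hF
      exact ⟨F, ⟨by rw [Set.Finite.mem_toFinset, himg]; exact ⟨F, hF, rfl⟩, rfl⟩,
        fun c hc => hc.2.symm⟩
  refine ⟨#hfin.toFinset, hfin.encard_eq_coe_toFinset_card, ?_⟩
  rw [hN, Finset.sum_const, nsmul_eq_mul] at hsum
  have hN' : N = #hfin.toFinset * (k + 1) := by exact_mod_cast hsum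
  have hc : #X = n + 1 := by simp [hX]
  rw [hN', hc, egfCount_minTreeSeries_pow_succ] at hq
  push_cast at hq
  have hk : (k : ℚ) + 1 ≠ 0 := by positivity
  rw [mul_comm] at hq
  exact mul_left_cancel₀ hk hq

theorem countIs_setB (n k : ℕ) : CountIs (setB n k) (commonNum n k) := by
  have := countIs_tailMinLists k (Finset.Icc 1 n)
  rwa [Nat.card_Icc, Nat.add_sub_cancel] at this

/-! ### Sequences of good forests as walks -/

theorem sdiff_union_eq (X A B : Finset ℕ) : X \ (A ∪ B) = (X \ A) \ B := by
  ext v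
  simp only [Finset.mem_sdiff, Finset.mem_union]
  tauto

/-- Sequences of `k`-good ordered forests whose vertex sets form a partition of `X`. -/
def goodSeqs (k : ℕ) (X : Finset ℕ) : Set (List (List RTree)) :=
  {L | (∀ F ∈ L, IsGood k F) ∧
    (L.Pairwise fun F G => Disjoint (vertsOf F) (vertsOf G)) ∧
    ∀ v, v ∈ X ↔ ∃ F ∈ L, v ∈ vertsOf F}

theorem nil_mem_goodSeqs {k : ℕ} {X : Finset ℕ} : [] ∈ goodSeqs k X ↔ X = ∅ := by
  simp [goodSeqs, Finset.eq_empty_iff_forall_notMem]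

theorem cons_mem_goodSeqs {k : ℕ} {X : Finset ℕ} {F : List RTree} {L : List (List RTree)} :
    F :: L ∈ goodSeqs k X ↔
      IsGood k F ∧ vertsOf F ⊆ X ∧ L ∈ goodSeqs k (X \ vertsOf F) := by
  simp only [goodSeqs, Set.mem_ofPred_eq, List.mem_cons, List.pairwise_cons,
    forall_eq_or_imp, or_and_right, exists_or, exists_eq_left, Finset.mem_sdiff, Finset.disjoint_left]
  constructor
  · rintro ⟨⟨h1, h2⟩, ⟨h3, h4⟩, h5⟩
    refine ⟨h1, fun v hv => (h5 v).2 (Or.inl hv), h2, h4, fun v => ⟨fun h => ?_, ?_⟩⟩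
    · exact ((h5 v).1 h.1).resolve_left h.2
    · rintro ⟨G, hG, hv⟩
      exact ⟨(h5 v).2 (Or.inr ⟨G, hG, hv⟩), fun h => h3 G hG h hv⟩
  · rintro ⟨h1, h6, h2, h4, h5⟩
    refine ⟨⟨h1, h2⟩, ⟨fun G hG v hv hvG => ((h5 v).2 ⟨G, hG, hvG⟩).2 hv, h4⟩,
      fun v => ⟨fun hv => ?_, ?_⟩⟩
    · by_cases h : v ∈ vertsOf F
      · exact Or.inl h
      · exact Or.inr ((h5 v).1 ⟨hv, h⟩)
    · rintro (h | h)
      · exact h6 h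
      · exact ((h5 v).2 h).1

theorem numSpecial_nil (k : ℕ) : numSpecial k [] = 0 := by simp [numSpecial]

theorem numSpecial_cons {k : ℕ} {T : RTree} {F : List RTree}
    (h : Disjoint T.verts (vertsOf F)) :
    numSpecial k (T :: F) = #(T.verts ∩ Finset.Icc 1 k) + numSpecial k F := by
  rw [numSpecial, vertsOf_cons, Finset.union_inter_distrib_right, Finset.card_union_of_disjoint]
  · rfl
  · exact h.mono Finset.inter_subset_left Finset.inter_subset_left

theorem vertsOf_take_subset (i : ℕ) (F : List RTree) : vertsOf (F.take i) ⊆ vertsOf F := by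
  intro v
  simp only [mem_vertsOf]
  rintro ⟨T, hT, hv⟩
  exact ⟨T, List.mem_of_mem_take hT, hv⟩

/-- Starting from `h`, the walk that at each tree of `R` goes down by one and up by the number of
vertices in `[k]` reaches `0` for the first time after the last tree. -/
def IsPassage (k h : ℕ) (R : List RTree) : Prop :=
  (∀ i < R.length, i < h + numSpecial k (R.take i)) ∧ R.length = h + numSpecial k R

theorem isPassage_nil {k h : ℕ} : IsPassage k h [] ↔ h = 0 := by
  simp [IsPassage, numSpecial_nil, eq_comm]

theorem isPassage_zero {k : ℕ} {R : List RTree} : IsPassage k 0 R ↔ R = [] := by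
  constructor
  · rintro ⟨h, -⟩
    by_contra hR
    have := h 0 (List.length_pos_iff.2 hR)
    simp [numSpecial_nil] at this
  · rintro rfl
    exact isPassage_nil.2 rfl

theorem isPassage_cons {k h : ℕ} {T : RTree} {R : List RTree}
    (hd : Disjoint T.verts (vertsOf R)) :
    IsPassage k (h + 1) (T :: R) ↔ IsPassage k (h + #(T.verts ∩ Finset.Icc 1 k)) R := by
  have hd' : ∀ i, Disjoint T.verts (vertsOf (R.take i)) := fun i =>
    hd.mono_right (vertsOf_take_subset i R)
  simp only [IsPassage, List.length_cons, numSpecial_cons hd]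
  refine and_congr ⟨fun H i hi => ?_, fun H i hi => ?_⟩ (by omega)
  · have := H (i + 1) (by omega)
    rw [List.take_succ_cons, numSpecial_cons (hd' i)] at this
    omega
  · rcases i with _ | i
    · omega
    · have := H i (by omega)
      rw [List.take_succ_cons, numSpecial_cons (hd' i)]
      omega

/-- The first tree only sets the starting height of the walk. With no further trees this height must
be 0, so the passage condition also covers a tree avoiding [k], and only the singleton in [k]
remains exceptional. -/
theorem goodCondition_cons {k : ℕ} {T : RTree} {R : List RTree}
    (hd : Disjoint T.verts (vertsOf R)) :
    GoodCondition k (T :: R) ↔ (R = [] ∧ ∃ v ∈ Finset.Icc 1 k, T.verts = {v}) ∨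
      (IsPassage k #(T.verts ∩ Finset.Icc 1 k) R ∧ ∀ S ∈ R, S.IsMinimallyRooted) := by
  rcases R with _ | ⟨S, R⟩
  · simp only [GoodCondition, true_and, isPassage_nil, Finset.card_eq_zero, List.not_mem_nil,
      false_imp_iff, implies_true, and_true, Finset.disjoint_iff_inter_eq_empty]
    exact or_comm
  · have hd' : ∀ i, Disjoint T.verts (vertsOf ((S :: R).take i)) := fun i =>
      hd.mono_right (vertsOf_take_subset i _)
    simp only [GoodCondition, reduceCtorEq, false_and, false_or]
    rw [and_comm, IsPassage, numSpecial_cons hd, List.length_cons]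
    refine and_congr_left fun _ => and_congr (forall₂_congr fun i _ => ?_) eq_comm
    rw [List.take_succ_cons, numSpecial_cons (hd' i)]
    rfl

/-- Pairs of a passage from `h` by minimally rooted trees and a sequence of `k`-good ordered
forests, whose vertex sets form a partition of `X`. -/
def passageSeqs (k h : ℕ) (X : Finset ℕ) : Set (List RTree × List (List RTree)) :=
  {x | IsPassage k h x.1 ∧ (∀ T ∈ x.1, T.IsMinimallyRooted) ∧ IsOrderedForest x.1 ∧
    vertsOf x.1 ⊆ X ∧ x.2 ∈ goodSeqs k (X \ vertsOf x.1)}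

theorem passageSeqs_zero (k : ℕ) (X : Finset ℕ) :
    passageSeqs k 0 X = (fun L => ([], L)) '' goodSeqs k X := by
  ext ⟨R, L⟩
  simp only [passageSeqs, isPassage_zero, Set.mem_ofPred_eq, Set.mem_image, Prod.mk.injEq]
  constructor
  · rintro ⟨rfl, -, -, -, h⟩
    exact ⟨L, by simpa using h, rfl, rfl⟩
  · rintro ⟨L, h, rfl, rfl⟩
    exact ⟨rfl, by simp, by simp [IsOrderedForest], by simp, by simpa using h⟩

theorem isOrderedForest_cons_and_subset_iff {X : Finset ℕ} {T : RTree} {R : List RTree} :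
    (IsOrderedForest (T :: R) ∧ vertsOf (T :: R) ⊆ X) ↔
      T.verts ⊆ X ∧ IsOrderedForest R ∧ vertsOf R ⊆ X \ T.verts := by
  rw [isOrderedForest_cons, vertsOf_cons, Finset.union_subset_iff, Finset.subset_sdiff]
  constructor
  · rintro ⟨⟨h1, h2⟩, h3, h4⟩
    exact ⟨h3, h2, h4, h1.symm⟩
  · rintro ⟨h3, h2, h4, h1⟩
    exact ⟨⟨h1.symm, h2⟩, h3, h4⟩

theorem passageSeqs_succ (k h : ℕ) (X : Finset ℕ) :
    passageSeqs k (h + 1) X = (fun x : RTree × (List RTree × List (List RTree)) =>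
      (x.1 :: x.2.1, x.2.2)) '' {x | x.1.IsMinimallyRooted ∧ x.1.verts ⊆ X ∧
        x.2 ∈ passageSeqs k (h + #(x.1.verts ∩ Finset.Icc 1 k)) (X \ x.1.verts)} := by
  ext ⟨R, L⟩
  constructor
  · rintro ⟨h1, h2, h3, h4, h5⟩
    dsimp only at h1 h2 h3 h4 h5
    rcases R with _ | ⟨T, R⟩
    · simp [isPassage_nil] at h1
    obtain ⟨a, b, c⟩ := isOrderedForest_cons_and_subset_iff.1 ⟨h3, h4⟩
    rw [isPassage_cons (isOrderedForest_cons.1 h3).1] at h1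
    rw [vertsOf_cons, sdiff_union_eq] at h5
    rw [List.forall_mem_cons] at h2
    exact ⟨(T, (R, L)), ⟨h2.1, a, h1, h2.2, b, c, h5⟩, rfl⟩
  · rintro ⟨⟨T, ⟨R, L⟩⟩, ⟨h2, a, h1, h2', b, c, h5⟩, h⟩
    obtain ⟨rfl, rfl⟩ := Prod.mk.inj h
    obtain ⟨h3, h4⟩ := isOrderedForest_cons_and_subset_iff.2 ⟨a, b, c⟩
    refine ⟨(isPassage_cons (isOrderedForest_cons.1 h3).1).2 h1,
      List.forall_mem_cons.2 ⟨h2, h2'⟩, h3, h4, ?_⟩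
    rw [vertsOf_cons, sdiff_union_eq]
    exact h5

theorem goodSeqs_eq (k : ℕ) (X : Finset ℕ) :
    goodSeqs k X = {L | L = [] ∧ X = ∅} ∪
      ((fun x : RTree × List (List RTree) => [x.1] :: x.2) ''
        {x | (∃ v ∈ Finset.Icc 1 k, x.1.verts = {v}) ∧ x.1.verts ⊆ X ∧
          x.2 ∈ goodSeqs k (X \ x.1.verts)} ∪
      (fun x : RTree × (List RTree × List (List RTree)) => (x.1 :: x.2.1) :: x.2.2) ''
        -- The conjunct `True` gives the set the shape of `countIs_pairs`, the first tree being
        -- arbitrary.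
        {x | True ∧ x.1.verts ⊆ X ∧
          x.2 ∈ passageSeqs k #(x.1.verts ∩ Finset.Icc 1 k) (X \ x.1.verts)}) := by
  ext L
  constructor
  · intro hL
    rcases L with _ | ⟨F, L⟩
    · exact Or.inl ⟨rfl, nil_mem_goodSeqs.1 hL⟩
    obtain ⟨⟨hF, hg⟩, hs, hL⟩ := cons_mem_goodSeqs.1 hL
    rcases F with _ | ⟨T, R⟩
    · exact hg.elim
    rw [goodCondition_cons (isOrderedForest_cons.1 hF).1] at hg
    rcases hg with ⟨rfl, hv⟩ | ⟨hp, hm⟩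
    · refine Or.inr (Or.inl ⟨(T, L), ⟨hv, ?_, ?_⟩, rfl⟩)
      · simpa using hs
      · simpa using hL
    · obtain ⟨a, b, c⟩ := isOrderedForest_cons_and_subset_iff.1 ⟨hF, hs⟩
      rw [vertsOf_cons, sdiff_union_eq] at hL
      exact Or.inr (Or.inr ⟨(T, (R, L)), ⟨trivial, a, hp, hm, b, c, hL⟩, rfl⟩)
  · rintro (⟨rfl, h⟩ | ⟨⟨T, L⟩, ⟨hv, hs, hL⟩, rfl⟩ |
      ⟨⟨T, R, L⟩, ⟨-, a, hp, hm, b, c, hL⟩, rfl⟩)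
    · exact nil_mem_goodSeqs.2 h
    · refine cons_mem_goodSeqs.2 ⟨⟨by simp [IsOrderedForest],
        (goodCondition_cons (by simp)).2 (Or.inl ⟨rfl, hv⟩)⟩, ?_, ?_⟩
      · simpa using hs
      · simpa using hL
    · obtain ⟨h3, h4⟩ := isOrderedForest_cons_and_subset_iff.2 ⟨a, b, c⟩
      refine cons_mem_goodSeqs.2 ⟨⟨h3, (goodCondition_cons (isOrderedForest_cons.1 h3).1).2
        (Or.inr ⟨hp, hm⟩)⟩, h4, ?_⟩
      rw [vertsOf_cons, sdiff_union_eq]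
      exact hL

theorem countIs_singletonTrees (K V : Finset ℕ) :
    CountIs {T : RTree | T.verts = V ∧ ∃ v ∈ K, T.verts = {v}}
      (open Classical in if ∃ v ∈ K, V = {v} then 1 else 0) := by
  split_ifs with h
  · obtain ⟨v, hv, rfl⟩ := h
    have := countIs_trees {v}
    have h1 : ((treeNum #({v} : Finset ℕ) : ℕ) : ℚ) = 1 := by simp [treeNum]
    rw [h1] at this
    convert this
    exact ⟨fun h => h.1, fun h => ⟨h, v, hv, h⟩⟩
  · convert CountIs.empty
    ext T
    simp only [Set.mem_ofPred_eq, Set.mem_empty_iff_false, iff_false]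
    rintro ⟨rfl, h'⟩
    exact h h'

theorem sum_singletons (K X : Finset ℕ) (b : Finset ℕ → ℚ) :
    ∑ V ∈ X.powerset, (open Classical in if ∃ v ∈ K, V = {v} then (1 : ℚ) else 0) * b V =
      ∑ v ∈ X ∩ K, b {v} := by
  classical
  rw [← Finset.sum_image (s := X ∩ K) (g := fun v => ({v} : Finset ℕ)) (f := b)
    (fun a _ c _ h => Finset.singleton_injective h)]
  rw [← Finset.sum_subset (s₁ := (X ∩ K).image fun v => ({v} : Finset ℕ))]
  · refine Finset.sum_congr rfl fun V hV => ?_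
    obtain ⟨v, hv, rfl⟩ := Finset.mem_image.1 hV
    rw [if_pos ⟨v, (Finset.mem_inter.1 hv).2, rfl⟩, one_mul]
  · intro V hV
    obtain ⟨v, hv, rfl⟩ := Finset.mem_image.1 hV
    simpa using (Finset.mem_inter.1 hv).1
  · intro V hV hV'
    rw [if_neg, zero_mul]
    rintro ⟨v, hv, rfl⟩
    refine hV' (Finset.mem_image.2 ⟨v, Finset.mem_inter.2 ⟨?_, hv⟩, rfl⟩)
    simpa using hV

theorem card_sdiff_inter_add {V X : Finset ℕ} (K : Finset ℕ) (hV : V ⊆ X) :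
    #((X \ V) ∩ K) + #(V ∩ K) = #(X ∩ K) := by
  rw [← Finset.card_union_of_disjoint, ← Finset.union_inter_distrib_right,
    Finset.sdiff_union_of_subset hV]
  exact Finset.sdiff_disjoint.mono Finset.inter_subset_left Finset.inter_subset_left

theorem card_sdiff_lt {V X : Finset ℕ} (hV : V ⊆ X) (hne : V.Nonempty) : #(X \ V) < #X := by
  have h1 := Finset.card_sdiff_of_subset hV
  have h2 := hne.card_pos
  have h3 := Finset.card_le_card hV
  omega

/-- The summands match the two exceptional starts of a good sequence: the empty sequence, and a
singleton at one of `j` special vertices. The truncated subtractions are harmless, since the second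
term has the factor `j`. -/
theorem egfCount_minTreeSeries_pow {n j : ℕ} (hj : j ≤ n) :
    egfCount (minTreeSeries ^ j) n = (if n = 0 then 1 else 0) + j * commonNum (n - 1) (j - 1) := by
  rcases n with _ | n
  · obtain rfl : j = 0 := by omega
    simp [egfCount_one]
  · rcases j with _ | j
    · simp [egfCount_one]
    · rw [egfCount_minTreeSeries_pow_succ]
      simp

/-- Induction on |X|, removing the first tree. At positive height it is minimally rooted and the
height drops by one, as in `commonNum_succ_eq_sum`. At height 0 a new good forest starts, or the
sequence ends, as in `commonNum_eq_add`. -/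
theorem countIs_passageSeqs (k h : ℕ) (X : Finset ℕ) :
    CountIs (passageSeqs k h X) (commonNum #X (#(X ∩ Finset.Icc 1 k) + h)) := by
  induction hn : #X using Nat.strong_induction_on generalizing X h with
  | _ n ih =>
  subst hn
  set K := Finset.Icc 1 k with hK
  have ih' : ∀ h, ∀ V ⊆ X, V.Nonempty → CountIs (passageSeqs k (h + #(V ∩ K)) (X \ V))
      (commonNum #(X \ V) (#(X ∩ K) + h)) := by
    intro h V hV hne
    have := ih #(X \ V) (card_sdiff_lt hV hne) (h + #(V ∩ K)) (X \ V) rfl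
    -- Special vertices used up by `V` reappear in the height, so the second parameter of
    -- `commonNum` does not depend on `V`.
    rwa [show #((X \ V) ∩ K) + (h + #(V ∩ K)) = #(X ∩ K) + h by
      have := card_sdiff_inter_add K hV; omega] at this
  rcases h with _ | h
  · rw [passageSeqs_zero]
    refine CountIs.image ?_ (fun L _ L' _ h => by simpa using h)
    rw [goodSeqs_eq, add_zero, commonNum_eq_add, egfCount_minTreeSeries_pow
      (Finset.card_le_card Finset.inter_subset_left), add_assoc]
    refine CountIs.union ?_ (CountIs.union ?_ ?_ ?_) ?_
    · split_ifs with h0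
      · convert CountIs.singleton ([] : List (List RTree))
        simp [Finset.card_eq_zero.1 h0]
      · convert CountIs.empty
        ext L
        simp only [Set.mem_ofPred_eq, Set.mem_empty_iff_false, iff_false]
        rintro ⟨-, rfl⟩
        simp at h0
    · have := (countIs_pairs (P := fun T => ∃ v ∈ K, T.verts = {v}) (X := X)
        (countIs_singletonTrees K) (B := fun V => goodSeqs k (X \ V))
        (b := fun V => commonNum #(X \ V) #((X \ V) ∩ K)) fun V hV hne => by
          have := ih #(X \ V) (card_sdiff_lt hV hne) 0 (X \ V) rfl
          rw [passageSeqs_zero] at this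
          refine this.congr_encard (Set.InjOn.encard_image ?_).symm
          exact fun L _ L' _ h => by simpa using h).image
          (f := fun x : RTree × List (List RTree) => [x.1] :: x.2) (fun x _ y _ h => by
            simp only [List.cons.injEq, and_true] at h
            exact Prod.ext h.1 h.2)
      convert this using 1
      rw [sum_singletons, Finset.sum_congr rfl
        (g := fun _ => commonNum (#X - 1) (#(X ∩ K) - 1)), Finset.sum_const, nsmul_eq_mul]
      intro v hv
      obtain ⟨h1, h2⟩ := Finset.mem_inter.1 hv
      have hs : {v} ⊆ X := by simpa using h1
      have h3 := card_sdiff_inter_add K hs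
      have h4 : #({v} ∩ K) = 1 := by simp [h2]
      rw [Finset.card_sdiff_of_subset hs, Finset.card_singleton]
      congr 1
      omega
    · refine (countIs_pairs (P := fun _ => True) (X := X) (t := fun V => (treeNum #V : ℚ))
        (fun V => by simpa using countIs_trees V)
        (B := fun V => passageSeqs k #(V ∩ K) (X \ V))
        (b := fun V => commonNum #(X \ V) #(X ∩ K)) fun V hV hne => by
          simpa using ih' 0 V hV hne).image
        (f := fun x : RTree × (List RTree × List (List RTree)) => (x.1 :: x.2.1) :: x.2.2) ?_
      rintro ⟨T, R, L⟩ - ⟨T', R', L'⟩ - h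
      simp only [List.cons.injEq] at h
      obtain ⟨⟨rfl, rfl⟩, rfl⟩ := h
      rfl
    · refine Set.disjoint_left.2 ?_
      rintro _ ⟨⟨T, L⟩, ⟨⟨v, hv, hT⟩, -⟩, rfl⟩ ⟨⟨T', R, L'⟩, ⟨-, -, hp, -⟩, h⟩
      simp only [List.cons.injEq] at h
      obtain ⟨⟨rfl, rfl⟩, rfl⟩ := h
      dsimp only at hT hp
      rw [isPassage_nil, hT] at hp
      simp [hv] at hp
    · refine Set.disjoint_left.2 ?_
      rintro _ ⟨rfl, -⟩ (⟨x, -, h⟩ | ⟨x, -, h⟩) <;> simp at h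
  · rw [passageSeqs_succ, ← add_assoc, commonNum_succ_eq_sum]
    refine (countIs_pairs (P := RTree.IsMinimallyRooted) (X := X)
      (t := fun V => (minTreeNum #V : ℚ)) countIs_minTrees
      (B := fun V => passageSeqs k (h + #(V ∩ K)) (X \ V)) (ih' h)).image ?_
    rintro ⟨T, R, L⟩ - ⟨T', R', L'⟩ - h
    simp only [Prod.mk.injEq, List.cons.injEq] at h
    obtain ⟨⟨rfl, rfl⟩, rfl⟩ := h
    rfl

/-- The parameter at height 0 is the size of [n] ∩ [k], which is `k` because `k ≤ n`. -/
theorem countIs_setC {n k : ℕ} (hk : k ≤ n) : CountIs (setC n k) (commonNum n k) := by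
  have := countIs_passageSeqs k 0 (Finset.Icc 1 n)
  rw [passageSeqs_zero, Finset.inter_eq_right.2 (Finset.Icc_subset_Icc_right hk), Nat.card_Icc,
    Nat.card_Icc, Nat.add_sub_cancel, Nat.add_sub_cancel, add_zero] at this
  exact this.congr_encard (Set.InjOn.encard_image (s := goodSeqs k (Finset.Icc 1 n))
    (fun L _ L' _ h => by simpa using h)).symm

/-! ### Forests of minimally rooted trees with varying root set -/

theorem forests_subset_piFun (c : ℕ → ℕ → Prop) (X R : Finset ℕ) :
    forests c X R ⊆ piFun X fun _ => X ∪ R :=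
  fun _ hp => ⟨hp.1, hp.2.1⟩

theorem forests_finite (c : ℕ → ℕ → Prop) (X R : Finset ℕ) : (forests c X R).Finite :=
  (Set.finite_of_encard_eq_coe (encard_piFun X fun _ => X ∪ R)).subset
    (forests_subset_piFun c X R)

/-- The number of forests of minimally rooted trees on `X` with set of roots `D`. -/
noncomputable def minForestNum (X D : Finset ℕ) : ℚ := (forests (· < ·) (X \ D) D).ncard

theorem countIs_minForests (X D : Finset ℕ) :
    CountIs (forests (· < ·) (X \ D) D) (minForestNum X D) :=
  ⟨_, (forests_finite _ _ _).cast_ncard_eq.symm, rfl⟩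

theorem CountIs.unique {α : Type*} {s : Set α} {q q' : ℚ} (h : CountIs s q) (h' : CountIs s q') :
    q = q' := by
  obtain ⟨N, hN, rfl⟩ := h
  obtain ⟨M, hM, rfl⟩ := h'
  rw [hN] at hM
  exact_mod_cast hM

theorem sum_minForestNum_singleton (U : Finset ℕ) :
    ∑ r ∈ U, minForestNum U {r} = minTreeNum #U := by
  refine CountIs.unique (CountIs.sum U (fun r T => T.root = r) _ ?_ fun r hr => ?_)
    (countIs_minTrees U)
  · rintro T ⟨rfl, -⟩
    exact ⟨T.root, ⟨T.root_mem, rfl⟩, fun r h => h.2.symm⟩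
  · have := countIs_minForests U {r}
    rw [Finset.sdiff_singleton_eq_erase] at this
    refine this.congr_encard ?_
    rw [← encard_minTrees_root hr]
    congr 1
    ext T
    simp only [Set.mem_ofPred_eq]
    tauto

theorem minForestNum_eq_sum {X D : Finset ℕ} {r : ℕ} (hr : r ∈ D) :
    minForestNum X D = ∑ V ∈ (X \ D).powerset,
      minForestNum (insert r V) {r} * minForestNum (X \ insert r V) (D.erase r) := by
  have hrX : r ∉ X \ D := fun h => (Finset.mem_sdiff.1 h).2 hr
  have h := encard_forests_insert (· < ·) (X := X \ D) (R := D.erase r) (r := r)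
    (Finset.sdiff_disjoint.mono_right (Finset.erase_subset _ _)) (by simp) hrX
  rw [Finset.insert_erase hr] at h
  obtain ⟨N, hN, hq⟩ := countIs_minForests X D
  rw [hN, Finset.sum_congr rfl (g := fun V => ((
      (forests (· < ·) (insert r V \ {r}) {r}).ncard *
      (forests (· < ·) ((X \ insert r V) \ D.erase r) (D.erase r)).ncard : ℕ) : ℕ∞)),
    ← Nat.cast_sum] at h
  · rw [← hq, Nat.cast_inj.1 h]
    push_cast
    rfl
  · intro V hV
    rw [Finset.mem_powerset] at hV
    have hrV : r ∉ V := fun h => hrX (hV h)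
    have e1 : insert r V \ {r} = V := by
      rw [Finset.sdiff_singleton_eq_erase, Finset.erase_insert hrV]
    have e2 : (X \ insert r V) \ D.erase r = (X \ D) \ V := by
      ext v
      simp only [Finset.mem_sdiff, Finset.mem_insert, Finset.mem_erase]
      by_cases hv : v = r
      · subst hv
        simp [hr]
      · simp only [hv, false_or, ne_eq, not_false_eq_true, true_and]
        tauto
    rw [e1, e2, Nat.cast_mul, (forests_finite _ _ _).cast_ncard_eq,
      (forests_finite _ _ _).cast_ncard_eq]

/-- Both sides count forests of j+1 minimally rooted trees with one tree marked; on the right `U` is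
the vertex set of the marked tree. -/
theorem sum_powersetCard_succ_minForestNum (X : Finset ℕ) (j : ℕ) :
    ∑ D ∈ X.powersetCard (j + 1), ((j : ℚ) + 1) * minForestNum X D =
      ∑ U ∈ X.powerset, (minTreeNum #U : ℚ) *
        ∑ D ∈ (X \ U).powersetCard j, minForestNum (X \ U) D := by
  have h1 : ∀ D ∈ X.powersetCard (j + 1), ((j : ℚ) + 1) * minForestNum X D =
      ∑ r ∈ D, ∑ V ∈ (X \ D).powerset,
        minForestNum (insert r V) {r} * minForestNum (X \ insert r V) (D.erase r) := by
    intro D hD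
    rw [Finset.mem_powersetCard] at hD
    rw [← Finset.sum_congr rfl fun r hr => minForestNum_eq_sum hr, Finset.sum_const, hD.2,
      nsmul_eq_mul]
    push_cast
    rfl
  have h2 : ∀ U ∈ X.powerset, (minTreeNum #U : ℚ) *
        ∑ D ∈ (X \ U).powersetCard j, minForestNum (X \ U) D =
      ∑ r ∈ U, ∑ D ∈ (X \ U).powersetCard j, minForestNum U {r} * minForestNum (X \ U) D := by
    intro U _
    rw [← sum_minForestNum_singleton, Finset.sum_mul]
    exact Finset.sum_congr rfl fun r _ => Finset.mul_sum _ _ _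
  rw [Finset.sum_congr rfl h1, Finset.sum_congr rfl h2]
  simp only [Finset.sum_sigma']
  -- Trading (D, r, V) for (V ∪ {r}, r, D \ {r}) is an involution, so the inverse has the same
  -- formula.
  refine Finset.sum_bij' (fun x _ => ⟨insert x.2.1 x.2.2, x.2.1, x.1.erase x.2.1⟩)
    (fun x _ => ⟨insert x.2.1 x.2.2, x.2.1, x.1.erase x.2.1⟩) ?_ ?_ ?_ ?_ ?_
  · rintro ⟨D, r, V⟩ h
    simp only [Finset.mem_sigma, Finset.mem_powersetCard, Finset.mem_powerset] at h ⊢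
    obtain ⟨⟨hD, hc⟩, hr, hV⟩ := h
    refine ⟨Finset.insert_subset (hD hr) (hV.trans Finset.sdiff_subset),
      Finset.mem_insert_self _ _, ?_, by rw [Finset.card_erase_of_mem hr, hc]; rfl⟩
    intro v hv
    obtain ⟨hne, hv⟩ := Finset.mem_erase.1 hv
    refine Finset.mem_sdiff.2 ⟨hD hv, fun h => ?_⟩
    rcases Finset.mem_insert.1 h with h | h
    · exact hne h
    · exact (Finset.mem_sdiff.1 (hV h)).2 hv
  · rintro ⟨U, r, D⟩ h
    simp only [Finset.mem_sigma, Finset.mem_powersetCard, Finset.mem_powerset] at h ⊢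
    obtain ⟨hU, hr, hD, hc⟩ := h
    have hrD : r ∉ D := fun h => (Finset.mem_sdiff.1 (hD h)).2 hr
    refine ⟨⟨Finset.insert_subset (hU hr) (hD.trans Finset.sdiff_subset), ?_⟩,
      Finset.mem_insert_self _ _, ?_⟩
    · rw [Finset.card_insert_of_notMem hrD, hc]
    · intro v hv
      obtain ⟨hne, hv⟩ := Finset.mem_erase.1 hv
      refine Finset.mem_sdiff.2 ⟨hU hv, fun h => ?_⟩
      rcases Finset.mem_insert.1 h with h | h
      · exact hne h
      · exact (Finset.mem_sdiff.1 (hD h)).2 hv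
  · rintro ⟨D, r, V⟩ h
    simp only [Finset.mem_sigma, Finset.mem_powersetCard, Finset.mem_powerset] at h
    have hrV : r ∉ V := fun h' => (Finset.mem_sdiff.1 (h.2.2 h')).2 h.2.1
    simp only [Finset.insert_erase h.2.1, Finset.erase_insert hrV]
  · rintro ⟨U, r, D⟩ h
    simp only [Finset.mem_sigma, Finset.mem_powersetCard, Finset.mem_powerset] at h
    have hrD : r ∉ D := fun h' => (Finset.mem_sdiff.1 (h.2.2.1 h')).2 h.2.1
    simp only [Finset.insert_erase h.2.1, Finset.erase_insert hrD]
  · rintro ⟨D, r, V⟩ h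
    rfl

/-- A forest of `j` trees has j! orderings; marking and removing one tree at a time gives the powers
of M. -/
theorem factorial_mul_sum_minForestNum (X : Finset ℕ) (j : ℕ) :
    (j.factorial : ℚ) * ∑ D ∈ X.powersetCard j, minForestNum X D =
      egfCount (minTreeSeries ^ j) #X := by
  induction j generalizing X with
  | zero =>
    rw [pow_zero, egfCount_one, Finset.powersetCard_zero, Finset.sum_singleton]
    simp only [minForestNum, Finset.sdiff_empty, Nat.factorial_zero, Nat.cast_one, one_mul,
      Finset.card_eq_zero]
    split_ifs with h
    · rw [h, forests_empty_left]
      simp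
    · rw [forests_empty_right _ (Finset.nonempty_iff_ne_empty.2 h)]
      simp
  | succ j ih =>
    have h := sum_powersetCard_succ_minForestNum X j
    rw [← Finset.mul_sum] at h
    rw [Nat.factorial_succ, pow_succ', egfCount_mul]
    push_cast
    rw [mul_comm ((j : ℚ) + 1), mul_assoc, h, Finset.mul_sum]
    refine Finset.sum_congr rfl fun U _ => ?_
    rw [← ih, show egfCount minTreeSeries #U = minTreeNum #U from egfCount_egf _ _]
    ring

/-! ### Maximal decreasing subtrees -/

namespace RTree

/-- `D` is the vertex set of the maximal decreasing subtree, described by the parent function. -/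
def IsDecreasingSet (T : RTree) (D : Finset ℕ) : Prop :=
  T.root ∈ D ∧ D ⊆ T.verts ∧ (∀ v ∈ D.erase T.root, T.parent v ∈ D ∧ v < T.parent v) ∧
    ∀ v ∈ T.verts \ D, T.parent v ∈ D → T.parent v < v

theorem IsSubtree.isChild {S T : RTree} (h : S.IsSubtree T) (hr : S.root = T.root) {u v : ℕ}
    (hc : S.IsChild u v) : T.IsChild u v := by
  obtain ⟨hv, p, hp, rfl⟩ := hc
  obtain ⟨V, G, r, hrm, hm, ht⟩ := S
  dsimp only at hr
  subst hr
  exact ⟨hv, p.mapLe h.2, hp.mapLe h.2, by simp [SimpleGraph.Walk.penultimate]⟩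

theorem isSubtree_of_parent {S T : RTree} (hr : S.root = T.root) (hv : S.verts ⊆ T.verts)
    (hp : ∀ v ∈ S.verts.erase S.root, S.parent v = T.parent v) : S.IsSubtree T := by
  have key : ∀ u v, S.IsChild u v → T.IsChild u v := by
    intro u v h
    rw [isChild_iff] at h ⊢
    refine ⟨?_, (hp v h.1).symm.trans h.2⟩
    rw [← hr]
    exact Finset.erase_subset_erase _ hv h.1
  refine ⟨hv, fun u v h => ?_⟩
  rw [adj_iff] at h ⊢
  exact h.imp (key _ _) (key _ _)

theorem exists_restrict (T : RTree) {D : Finset ℕ} (hr : T.root ∈ D) (hD : D ⊆ T.verts)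
    (hcl : ∀ v ∈ D.erase T.root, T.parent v ∈ D) :
    ∃ S : RTree, S.verts = D ∧ S.root = T.root ∧ S.IsSubtree T ∧
      ∀ v ∈ D.erase T.root, S.parent v = T.parent v := by
  set p : ℕ → ℕ := fun v => if v ∈ D.erase T.root then T.parent v else v with hpdef
  have hpv : ∀ v ∈ D.erase T.root, p v = T.parent v := fun v hv => if_pos hv
  have hp : p ∈ forests (fun _ _ => True) (D.erase T.root) {T.root} := by
    refine ⟨fun v hv => if_neg hv, fun v hv => ?_, by simp, fun S hS hinv => ?_⟩
    · rw [Finset.union_comm, ← Finset.insert_eq, Finset.insert_erase hr, hpv v hv]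
      exact hcl v hv
    · refine T.parent_mem_forests.2.2.2 S (hS.trans (Finset.erase_subset_erase _ hD))
        fun v hv => ?_
      rw [← hpv v (hS hv)]
      exact hinv v hv
  have hpar : ∀ v ∈ D.erase T.root, (ofParent hr hp).parent v = T.parent v := fun v hv => by
    rw [parent_ofParent, hpv v hv]
  exact ⟨ofParent hr hp, rfl, rfl, isSubtree_of_parent rfl hD hpar, hpar⟩

theorem IsDecreasingSubtree.parent {S T : RTree} (h : S.IsDecreasingSubtree T) {v : ℕ}
    (hv : v ∈ S.verts.erase T.root) : T.parent v ∈ S.verts ∧ v < T.parent v := by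
  obtain ⟨h1, h2, h3⟩ := h
  rw [← h2] at hv
  have hc := S.isChild_parent hv
  have e : T.parent v = S.parent v := (T.isChild_iff.1 (h1.isChild h2 hc)).2
  rw [e]
  exact ⟨S.parent_mem hv, h3 _ _ hc⟩

/-- A subtree with the same root is determined by a vertex set closed under parents, so both
decrease and maximality can be read off the parent function. -/
theorem exists_isMaximalDecreasingSubtree_iff (T : RTree) (j : ℕ) :
    (∃ M : RTree, M.IsMaximalDecreasingSubtree T ∧ #M.verts = j) ↔
      ∃ D, T.IsDecreasingSet D ∧ #D = j := by
  have hdec : ∀ S : RTree, ∀ D, S.verts = D → S.root = T.root →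
      (∀ v ∈ D.erase T.root, S.parent v = T.parent v) →
      (∀ v ∈ D.erase T.root, v < T.parent v) → S.IsDecreasing := by
    rintro S D rfl hr hp hlt u v h
    obtain ⟨h1, rfl⟩ := S.isChild_iff.1 h
    rw [hr] at h1
    rw [hp v h1]
    exact hlt v h1
  constructor
  · rintro ⟨M, ⟨hM, hmax⟩, hc⟩
    have hrM : T.root ∈ M.verts := hM.2.1 ▸ M.root_mem
    refine ⟨M.verts, ⟨hrM, hM.1.1, fun v hv => hM.parent hv,
      fun v hv hpv => ?_⟩, hc⟩
    by_contra hlt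
    obtain ⟨hvT, hvM⟩ := Finset.mem_sdiff.1 hv
    have hvr : v ≠ T.root := fun h => hvM (h ▸ hrM)
    have hne : T.parent v ≠ v := fun h => hvM (h ▸ hpv)
    have hlt' : v < T.parent v := lt_of_le_of_ne (not_lt.1 hlt) hne.symm
    have hall : ∀ w ∈ (insert v M.verts).erase T.root,
        T.parent w ∈ insert v M.verts ∧ w < T.parent w := by
      intro w hw
      obtain ⟨hwr, hw⟩ := Finset.mem_erase.1 hw
      rcases Finset.mem_insert.1 hw with rfl | hw
      · exact ⟨Finset.mem_insert_of_mem hpv, hlt'⟩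
      · have := hM.parent (Finset.mem_erase.2 ⟨hwr, hw⟩)
        exact ⟨Finset.mem_insert_of_mem this.1, this.2⟩
    -- An outside vertex smaller than its parent in `M` could be added, against maximality.
    obtain ⟨S, hS1, hS2, hS3, hS4⟩ := T.exists_restrict (D := insert v M.verts)
      (Finset.mem_insert_of_mem hrM) (Finset.insert_subset hvT hM.1.1) fun w hw => (hall w hw).1
    have := (hmax S ⟨hS3, hS2, hdec S _ hS1 hS2 hS4 fun w hw => (hall w hw).2⟩).1
    rw [hS1] at this
    exact hvM (this (Finset.mem_insert_self _ _))
  · rintro ⟨D, ⟨h1, h2, h3, h4⟩, hc⟩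
    obtain ⟨M, hM1, hM2, hM3, hM4⟩ := T.exists_restrict h1 h2 fun v hv => (h3 v hv).1
    refine ⟨M, ⟨⟨hM3, hM2, hdec M D hM1 hM2 hM4 fun v hv => (h3 v hv).2⟩, fun S hS => ?_⟩,
      by rw [hM1, hc]⟩
    have hSD : S.verts ⊆ D := by
      rw [← Finset.sdiff_eq_empty_iff_subset]
      refine T.parent_mem_forests.2.2.2 _ (fun v hv => ?_) fun v hv => ?_
      · obtain ⟨hvS, hvD⟩ := Finset.mem_sdiff.1 hv
        exact Finset.mem_erase.2 ⟨fun h => hvD (h ▸ h1), hS.1.1 hvS⟩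
      · obtain ⟨hvS, hvD⟩ := Finset.mem_sdiff.1 hv
        have hvr : v ≠ T.root := fun h => hvD (h ▸ h1)
        have := hS.parent (Finset.mem_erase.2 ⟨hvr, hvS⟩)
        exact Finset.mem_sdiff.2 ⟨this.1, fun h =>
          lt_asymm this.2 (h4 v (Finset.mem_sdiff.2 ⟨hS.1.1 hvS, hvD⟩) h)⟩
    refine isSubtree_of_parent (hS.2.1.trans hM2.symm) (hM1 ▸ hSD) fun v hv => ?_
    have e := (T.isChild_iff.1 (hS.1.isChild hS.2.1 (S.isChild_parent hv))).2
    rw [← e, hM4]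
    rw [hS.2.1] at hv
    exact Finset.erase_subset_erase _ hSD hv

/-- The parent of a vertex of `D \ D'` is larger and lies in `D`. It is not in `D'`, where it would
have to be smaller; so the difference is invariant and hence empty. -/
theorem IsDecreasingSet.subset {T : RTree} {D D' : Finset ℕ} (h : T.IsDecreasingSet D)
    (h' : T.IsDecreasingSet D') : D ⊆ D' := by
  rw [← Finset.sdiff_eq_empty_iff_subset]
  have hr : ∀ v ∈ D \ D', v ≠ T.root := fun v hv e => (Finset.mem_sdiff.1 hv).2 (e ▸ h'.1)
  refine T.parent_mem_forests.2.2.2 _ (fun v hv => ?_) fun v hv => ?_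
  · exact Finset.mem_erase.2 ⟨hr v hv, h.2.1 (Finset.mem_sdiff.1 hv).1⟩
  · obtain ⟨hvD, hvD'⟩ := Finset.mem_sdiff.1 hv
    have := h.2.2.1 v (Finset.mem_erase.2 ⟨hr v hv, hvD⟩)
    exact Finset.mem_sdiff.2 ⟨this.1, fun hp =>
      lt_asymm this.2 (h'.2.2.2 v (Finset.mem_sdiff.2 ⟨h.2.1 hvD, hvD'⟩) hp)⟩

theorem IsDecreasingSet.root_eq {T : RTree} {D : Finset ℕ} (h : T.IsDecreasingSet D)
    (hne : D.Nonempty) : T.root = D.max' hne := by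
  by_contra hr
  have := h.2.2.1 (D.max' hne) (Finset.mem_erase.2 ⟨fun e => hr e.symm, D.max'_mem hne⟩)
  exact absurd (D.le_max' _ this.1) (not_le.2 this.2)

end RTree

/-- The nonmaximal elements have 1, 2, …, |D| - 1 larger elements. This counts the decreasing trees
on `D`: each nonroot chooses any larger vertex as parent. -/
theorem prod_card_filter_lt_erase_max {D : Finset ℕ} (hne : D.Nonempty) :
    ∏ v ∈ D.erase (D.max' hne), #{u ∈ D | v < u} = (#D - 1).factorial := by
  -- The value 1 at 0 neutralizes the factor of the maximum.
  have h1 := prod_card_filter_lt (fun g => if g = 0 then 1 else g) D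
  have hm : #{u ∈ D | D.max' hne < u} = 0 := by
    rw [Finset.card_eq_zero, Finset.filter_eq_empty_iff]
    exact fun u hu => not_lt.2 (D.le_max' u hu)
  rw [← Finset.mul_prod_erase _ _ (D.max'_mem hne), hm, if_pos rfl, one_mul] at h1
  obtain ⟨m, hm'⟩ := Nat.exists_eq_succ_of_ne_zero hne.card_pos.ne'
  rw [hm', Finset.prod_range_succ'] at h1
  simp only [Nat.add_eq_zero_iff, one_ne_zero, and_false, if_false, if_true, mul_one,
    Finset.prod_range_add_one_eq_factorial] at h1
  rw [hm', Nat.succ_eq_add_one, Nat.add_sub_cancel, ← h1]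
  refine Finset.prod_congr rfl fun v hv => ?_
  obtain ⟨h2, h3⟩ := Finset.mem_erase.1 hv
  rw [if_neg]
  refine (Finset.card_pos.2 ⟨D.max' hne, Finset.mem_filter.2 ⟨D.max'_mem hne, ?_⟩⟩).ne'
  exact lt_of_le_of_ne (D.le_max' v h3) h2

/-- The parents inside and outside `D` are chosen independently: a map raising labels inside `D`,
and a forest over the root set `D` with children of roots larger than their parents. -/
theorem encard_forests_decreasing {X D : Finset ℕ} {m : ℕ} (hD : D ⊆ X) (hm : m ∈ D) :
    {p ∈ forests (fun _ _ => True) (X.erase m) {m} | (∀ v ∈ D.erase m, p v ∈ D ∧ v < p v) ∧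
      ∀ v ∈ X \ D, p v ∈ D → p v < v}.encard =
    (piFun (D.erase m) fun v => {u ∈ D | v < u}).encard *
      (forests (· < ·) (X \ D) D).encard := by
  rw [← encard_prod_eq]
  have hmX : m ∈ X := hD hm
  have hX : X.erase m ∪ {m} = X := by
    rw [Finset.union_comm, ← Finset.insert_eq, Finset.insert_erase hmX]
  have hXD : X \ D ∪ D = X := Finset.sdiff_union_of_subset hD
  have hsub : X \ D ⊆ X.erase m := fun v hv => by
    obtain ⟨h1, h2⟩ := Finset.mem_sdiff.1 hv
    exact Finset.mem_erase.2 ⟨fun h => h2 (h ▸ hm), h1⟩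
  refine encard_eq_of_inv
    (fun p => (fun v => if v ∈ D.erase m then p v else v, fun v => if v ∈ X \ D then p v else v))
    (fun q v => if v ∈ D.erase m then q.1 v else q.2 v) ?_ ?_ ?_ ?_
  · rintro p ⟨⟨h1, h2, -, h4⟩, h5, h6⟩
    rw [hX] at h2
    refine ⟨⟨fun v hv => if_neg hv, fun v hv => ?_⟩, fun v hv => if_neg hv, fun v hv => ?_,
      fun v hv => ?_, fun S hS hinv => ?_⟩
    · simp only [if_pos hv]
      exact Finset.mem_filter.2 (h5 v hv)
    · simp only [if_pos hv, hXD]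
      exact h2 v (hsub hv)
    · simp only [if_pos hv]
      exact h6 v hv
    · refine h4 S (hS.trans hsub) fun v hv => ?_
      have := hinv v hv
      dsimp only at this
      rwa [if_pos (hS hv)] at this
  · rintro ⟨g, q⟩ ⟨⟨g1, g2⟩, q1, q2, q3, q4⟩
    dsimp only at g1 g2 q1 q2 q3 q4
    simp only [Finset.mem_filter] at g2
    rw [hXD] at q2
    have hoff : ∀ v ∈ X \ D, v ∉ D.erase m := fun v hv h =>
      (Finset.mem_sdiff.1 hv).2 (Finset.mem_of_mem_erase h)
    refine ⟨⟨fun v hv => ?_, fun v hv => ?_, by simp, fun S hS hinv => ?_⟩, fun v hv => ?_,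
      fun v hv => ?_⟩
    · have hv1 : v ∉ D.erase m := fun h => hv (Finset.erase_subset_erase _ hD h)
      simp only [hv1, if_false]
      exact q1 v fun h => hv (hsub h)
    · rw [hX]
      by_cases hvD : v ∈ D.erase m
      · simp only [hvD, if_true]
        exact hD (g2 v hvD).1
      · simp only [hvD, if_false]
        obtain ⟨h1, h2⟩ := Finset.mem_erase.1 hv
        exact q2 v (Finset.mem_sdiff.2 ⟨h2, fun h => hvD (Finset.mem_erase.2 ⟨h1, h⟩)⟩)
    · have hSD : ∀ v ∈ S, v ∉ D := by
        intro v hv hvD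
        -- The largest element of `S ∩ D` would have a larger parent in the same set.
        obtain ⟨w, hw, hmax⟩ := Finset.exists_max_image (S ∩ D) id
          ⟨v, Finset.mem_inter.2 ⟨hv, hvD⟩⟩
        obtain ⟨hwS, hwD⟩ := Finset.mem_inter.1 hw
        have hwe : w ∈ D.erase m := Finset.mem_erase.2 ⟨(Finset.mem_erase.1 (hS hwS)).1, hwD⟩
        have h1 := hinv w hwS
        simp only [hwe, if_true] at h1
        have h2 := g2 w hwe
        exact absurd (hmax _ (Finset.mem_inter.2 ⟨h1, h2.1⟩)) (not_le.2 h2.2)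
      refine q4 S (fun v hv => Finset.mem_sdiff.2
        ⟨Finset.mem_of_mem_erase (hS hv), hSD v hv⟩) fun v hv => ?_
      have := hinv v hv
      dsimp only at this
      rwa [if_neg fun h => hSD v hv (Finset.mem_of_mem_erase h)] at this
    · simp only [hv, if_true]
      exact g2 v hv
    · simp only [hoff v hv, if_false]
      exact q3 v hv
  · rintro p ⟨hp, -⟩
    funext v
    by_cases hv : v ∈ D.erase m
    · simp only [hv, if_true]
    · by_cases hX : v ∈ X \ D
      · simp only [hv, hX, if_true, if_false]
      · simp only [hv, hX, if_false]
        refine (hp.1 v fun h => ?_).symm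
        obtain ⟨h1, h2⟩ := Finset.mem_erase.1 h
        exact hX (Finset.mem_sdiff.2 ⟨h2, fun h => hv (Finset.mem_erase.2 ⟨h1, h⟩)⟩)
  · rintro ⟨g, q⟩ ⟨⟨g1, g2⟩, q1, -⟩
    refine Prod.ext (funext fun v => ?_) (funext fun v => ?_)
    · by_cases hv : v ∈ D.erase m
      · simp only [hv, if_true]
      · simp only [hv, if_false]
        exact (g1 v hv).symm
    · by_cases hv : v ∈ X \ D
      · have : v ∉ D.erase m := fun h =>
          (Finset.mem_sdiff.1 hv).2 (Finset.mem_of_mem_erase h)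
        simp only [hv, this, if_true, if_false]
      · simp only [hv, if_false]
        exact (q1 v hv).symm

theorem countIs_isDecreasingSet {X D : Finset ℕ} (hD : D ⊆ X) (hne : D.Nonempty) :
    CountIs {T : RTree | T.verts = X ∧ T.IsDecreasingSet D}
      ((#D - 1).factorial * minForestNum X D) := by
  set m := D.max' hne with hm
  have hmD : m ∈ D := D.max'_mem hne
  have h1 : {T : RTree | T.verts = X ∧ T.IsDecreasingSet D} =
      {T : RTree | T.verts = X ∧ T.root = m ∧ ((∀ v ∈ D.erase m, T.parent v ∈ D ∧ v < T.parent v) ∧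
        ∀ v ∈ X \ D, T.parent v ∈ D → T.parent v < v)} := by
    ext T
    constructor
    · rintro ⟨rfl, h⟩
      have hr := h.root_eq hne
      refine ⟨rfl, hr, ?_, h.2.2.2⟩
      have := h.2.2.1
      rwa [hr] at this
    · rintro ⟨rfl, hr, h2, h3⟩
      refine ⟨rfl, hr ▸ hmD, hD, ?_, h3⟩
      rwa [hr]
  have h2 := RTree.encard_trees_eq (hD hmD) fun p =>
    (∀ v ∈ D.erase m, p v ∈ D ∧ v < p v) ∧ ∀ v ∈ X \ D, p v ∈ D → p v < v
  rw [h1]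
  have h3 := CountIs.of_encard (encard_piFun (D.erase m) fun v => {u ∈ D | v < u})
  rw [prod_card_filter_lt_erase_max hne] at h3
  refine (h3.prod (countIs_minForests X D)).congr_encard ?_
  rw [h2, encard_forests_decreasing hD hmD, encard_prod_eq]

/-- The trees are sorted by the vertex set `D` of the maximal decreasing subtree. Its factor k!
turns (k+1)! into the factor k+1 that cancels. -/
theorem countIs_setT (n k : ℕ) : CountIs (setT n k) (commonNum n k) := by
  set X := Finset.Icc 1 (n + 1) with hX
  have h := CountIs.sum (s := setT n k) (X.powersetCard (k + 1)) (fun D T => T.IsDecreasingSet D)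
    (fun D => (k.factorial : ℚ) * minForestNum X D) ?_ ?_
  · rw [← Finset.mul_sum] at h
    have h2 := factorial_mul_sum_minForestNum X (k + 1)
    have hc : #X = n + 1 := by simp [hX]
    rw [hc, egfCount_minTreeSeries_pow_succ, Nat.factorial_succ] at h2
    push_cast at h2
    have hk : (k : ℚ) + 1 ≠ 0 := by positivity
    rw [mul_assoc] at h2
    rwa [mul_left_cancel₀ hk h2] at h
  · rintro T ⟨hT, hM⟩
    obtain ⟨D, hD, hc⟩ := (T.exists_isMaximalDecreasingSubtree_iff _).1 hM
    refine ⟨D, ⟨Finset.mem_powersetCard.2 ⟨hD.2.1.trans hT.subset, hc⟩, hD⟩, ?_⟩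
    rintro D' ⟨-, hD'⟩
    exact (hD'.subset hD).antisymm (hD.subset hD')
  · intro D hD
    obtain ⟨hDX, hc⟩ := Finset.mem_powersetCard.1 hD
    have := countIs_isDecreasingSet hDX (Finset.card_pos.1 (by omega))
    rw [hc, Nat.add_sub_cancel] at this
    convert this using 1
    ext T
    simp only [setT, Set.mem_ofPred_eq, ← hX, RTree.exists_isMaximalDecreasingSubtree_iff]
    constructor
    · rintro ⟨⟨h1, -⟩, h2⟩
      exact ⟨h1, h2⟩
    · rintro ⟨h1, h2⟩
      exact ⟨⟨h1, D, h2, hc⟩, h2⟩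

/-! ### Trees with prescribed leaves -/

theorem RTree.isLeaf_iff (T : RTree) {i : ℕ} :
    T.IsLeaf i ↔ i ∈ T.verts ∧ ∀ w ∈ T.verts.erase T.root, T.parent w ≠ i := by
  simp only [RTree.IsLeaf, RTree.isChild_iff, not_and, ne_eq]

theorem RTree.isNonleaf_iff (T : RTree) {i : ℕ} (hi : i ∈ T.verts) :
    T.IsNonleaf i ↔ ¬ T.IsLeaf i := by
  simp [RTree.IsNonleaf, RTree.IsLeaf, hi]

/-- Attaching the elements of `S` as leaves. -/
theorem encard_forests_leaves {V S : Finset ℕ} {r : ℕ} (hS : S ⊆ V) (hr : r ∈ V) (hrS : r ∉ S) :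
    {p ∈ forests (fun _ _ => True) (V.erase r) {r} | ∀ v ∈ V.erase r, p v ∉ S}.encard =
      (forests (fun _ _ => True) ((V \ S).erase r) {r}).encard *
        (piFun S fun _ => V \ S).encard := by
  rw [← encard_prod_eq]
  have hV : V.erase r ∪ {r} = V := by
    rw [Finset.union_comm, ← Finset.insert_eq, Finset.insert_erase hr]
  have hVS : (V \ S).erase r ∪ {r} = V \ S := by
    rw [Finset.union_comm, ← Finset.insert_eq,
      Finset.insert_erase (Finset.mem_sdiff.2 ⟨hr, hrS⟩)]
  have hSV : S ⊆ V.erase r := fun v hv =>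
    Finset.mem_erase.2 ⟨fun h => hrS (h ▸ hv), hS hv⟩
  have hsub : (V \ S).erase r ⊆ V.erase r := Finset.erase_subset_erase _ Finset.sdiff_subset
  have hmem : ∀ v ∈ V.erase r, v ∉ S → v ∈ (V \ S).erase r := fun v hv h =>
    Finset.mem_erase.2 ⟨(Finset.mem_erase.1 hv).1,
      Finset.mem_sdiff.2 ⟨(Finset.mem_erase.1 hv).2, h⟩⟩
  have hnot : ∀ v ∈ (V \ S).erase r, v ∉ S := fun v hv =>
    (Finset.mem_sdiff.1 (Finset.mem_of_mem_erase hv)).2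
  refine encard_eq_of_inv
    (fun p => (fun v => if v ∈ (V \ S).erase r then p v else v, fun v => if v ∈ S then p v else v))
    (fun q v => if v ∈ S then q.2 v else q.1 v) ?_ ?_ ?_ ?_
  · rintro p ⟨⟨h1, h2, -, h4⟩, h5⟩
    rw [hV] at h2
    refine ⟨⟨fun v hv => if_neg hv, fun v hv => ?_, by simp, fun A hA hinv => ?_⟩,
      fun v hv => if_neg hv, fun v hv => ?_⟩
    · simp only [if_pos hv, hVS]
      exact Finset.mem_sdiff.2 ⟨h2 v (hsub hv), h5 v (hsub hv)⟩
    · refine h4 A (hA.trans hsub) fun v hv => ?_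
      have := hinv v hv
      dsimp only at this
      rwa [if_pos (hA hv)] at this
    · simp only [if_pos hv]
      exact Finset.mem_sdiff.2 ⟨h2 v (hSV hv), h5 v (hSV hv)⟩
  · rintro ⟨q, g⟩ ⟨⟨q1, q2, -, q4⟩, g1, g2⟩
    dsimp only at g1 g2 q1 q2 q4
    rw [hVS] at q2
    have key : ∀ v ∈ V.erase r, (if v ∈ S then g v else q v) ∈ V \ S := by
      intro v hv
      by_cases h : v ∈ S
      · simpa only [h, if_true] using g2 v h
      · simpa only [h, if_false] using q2 v (hmem v hv h)
    refine ⟨⟨fun v hv => ?_, fun v hv => ?_, by simp, fun A hA hinv => ?_⟩,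
      fun v hv => (Finset.mem_sdiff.1 (key v hv)).2⟩
    · have h : v ∉ S := fun h => hv (hSV h)
      simp only [h, if_false]
      exact q1 v fun h => hv (hsub h)
    · rw [hV]
      exact (Finset.mem_sdiff.1 (key v hv)).1
    -- No value lies in `S`, so `A \ S` is invariant under `q` and empty. Then `A ⊆ S`, while its
    -- images avoid `S`, so `A` is empty too.
    · have hAS : A \ S = ∅ := by
        refine q4 _ (fun v hv => ?_) fun v hv => ?_
        · exact hmem v (hA (Finset.mem_sdiff.1 hv).1) (Finset.mem_sdiff.1 hv).2
        · obtain ⟨h1, h2⟩ := Finset.mem_sdiff.1 hv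
          have h3 := hinv v h1
          have h4 := (Finset.mem_sdiff.1 (key v (hA h1))).2
          simp only [h2, if_false] at h3 h4
          exact Finset.mem_sdiff.2 ⟨h3, h4⟩
      rw [Finset.sdiff_eq_empty_iff_subset] at hAS
      by_contra hne
      obtain ⟨v, hv⟩ := Finset.nonempty_iff_ne_empty.2 hne
      exact (Finset.mem_sdiff.1 (key v (hA hv))).2 (hAS (hinv v hv))
  · rintro p ⟨hp, -⟩
    funext v
    by_cases hv : v ∈ S
    · simp only [hv, if_true]
    · by_cases hv' : v ∈ (V \ S).erase r
      · simp only [hv, hv', if_true, if_false]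
      · simp only [hv, hv', if_false]
        exact (hp.1 v fun h => hv' (hmem v h hv)).symm
  · rintro ⟨q, g⟩ ⟨⟨q1, -⟩, g1, -⟩
    refine Prod.ext (funext fun v => ?_) (funext fun v => ?_)
    · by_cases hv : v ∈ (V \ S).erase r
      · simp only [hv, hnot v hv, if_true, if_false]
      · simp only [hv, if_false]
        exact (q1 v hv).symm
    · by_cases hv : v ∈ S
      · simp only [hv, if_true]
      · simp only [hv, if_false]
        exact (g1 v hv).symm

/-- With m = |V| - |S| > 0 and |V| > 1, there are m^(m-1) rooted trees on the other vertices, and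
each element of `S` is attached to any of these m vertices. -/
theorem encard_trees_leaves {V S : Finset ℕ} (hS : S ⊆ V) (hV : V.Nonempty) :
    {T : RTree | T.verts = V ∧ ∀ i ∈ S, T.IsLeaf i}.encard =
      (((#V - #S) ^ (#V - 1) : ℕ) : ℕ∞) := by
  rcases Nat.lt_or_ge 1 #V with h1 | h1
  · rw [encard_eq_sum_root]
    have hroot : ∀ r ∈ V, {T : RTree | T.verts = V ∧ T.root = r ∧ ∀ i ∈ S, T.IsLeaf i}.encard =
        {p ∈ forests (fun _ _ => True) (V.erase r) {r} | ∀ v ∈ V.erase r, p v ∉ S}.encard := by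
      intro r hr
      rw [← RTree.encard_trees_eq hr fun p => ∀ v ∈ V.erase r, p v ∉ S]
      congr 1
      ext T
      simp only [Set.mem_ofPred_eq, RTree.isLeaf_iff]
      constructor
      · rintro ⟨rfl, rfl, h⟩
        exact ⟨rfl, rfl, fun v hv hp => (h _ hp).2 v hv rfl⟩
      · rintro ⟨rfl, rfl, h⟩
        exact ⟨rfl, rfl, fun i hi => ⟨hS hi, fun w hw e => h w hw (e ▸ hi)⟩⟩
    rw [← Finset.sum_subset (s₁ := V \ S) Finset.sdiff_subset]
    · have hc : #(V \ S) = #V - #S := Finset.card_sdiff_of_subset hS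
      have hle := Finset.card_le_card hS
      rw [Finset.sum_congr rfl (g := fun _ =>
        ((forestNum (#V - #S - 1) 1 * (#V - #S) ^ #S : ℕ) : ℕ∞))]
      · rw [Finset.sum_const, nsmul_eq_mul, ← Nat.cast_mul, hc]
        congr 1
        rcases Nat.eq_zero_or_pos (#V - #S) with h0 | h0
        · rw [h0, zero_mul, zero_pow (by omega)]
        · obtain ⟨m, hm⟩ := Nat.exists_eq_succ_of_ne_zero h0.ne'
          have e : #V - 1 = m + #S := by omega
          rw [e, hm, pow_add, forestNum, Nat.succ_eq_add_one, Nat.add_sub_cancel, ← mul_assoc]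
          rcases m with _ | m
          · simp
          · simp [pow_succ, mul_comm]
      · intro r hr
        obtain ⟨hrV, hrS⟩ := Finset.mem_sdiff.1 hr
        rw [hroot r hrV, encard_forests_leaves hS hrV hrS, encard_piFun,
          encard_forests_true (by simp), Finset.card_erase_of_mem hr, Finset.prod_const, hc,
          Finset.card_singleton, Nat.cast_mul]
    -- A root in `S` has no children, so the parent function would map all nonroots to nonroots.
    · intro r hr hr'
      have hrS : r ∈ S := by
        by_contra h
        exact hr' (Finset.mem_sdiff.2 ⟨hr, h⟩)
      rw [hroot r hr, Set.encard_eq_zero, Set.eq_empty_iff_forall_notMem]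
      rintro p ⟨⟨-, h2, -, h4⟩, h5⟩
      have := h4 _ subset_rfl fun v hv => by
        have h6 := h2 v hv
        rw [Finset.mem_union, Finset.mem_singleton] at h6
        exact h6.resolve_right fun e => h5 v hv (e ▸ hrS)
      have h6 := Finset.card_erase_of_mem hr
      rw [this, Finset.card_empty] at h6
      omega
  -- In a one-vertex tree the root is a leaf, so `S = V` is possible; the formula then reads 0^0 =
  -- 1.
  · have hpos := hV.card_pos
    have hc : #V = 1 := by omega
    have := encard_trees V
    rw [hc] at this ⊢
    rw [Nat.sub_self, pow_zero]
    rw [show treeNum 1 = 1 by simp [treeNum]] at this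
    rw [← this]
    congr 1
    ext T
    simp only [Set.mem_ofPred_eq, and_iff_left_iff_imp, RTree.isLeaf_iff]
    rintro rfl i hi
    have h0 : T.verts.erase T.root = ∅ := by
      rw [← Finset.card_eq_zero, Finset.card_erase_of_mem T.root_mem, hc]
    exact ⟨hS hi, by simp [h0]⟩

/-! ### Inclusion–exclusion for trees and maps -/

/-- The number counts `setT n k`, which is empty because a subtree with k+1 vertices does not fit
into [n+1]. -/
theorem commonNum_eq_zero {n k : ℕ} (h : n < k) : commonNum n k = 0 := by
  have h1 : setT n k = ∅ := by
    rw [Set.eq_empty_iff_forall_notMem]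
    rintro T ⟨hT, M, hM, hc⟩
    have := Finset.card_le_card hM.1.1.1
    rw [hT, hc, Nat.card_Icc] at this
    omega
  exact (h1 ▸ countIs_setT n k).unique CountIs.empty

/-- A finite family of finite sets, split according to whether a point is hit or missed, is counted
by `commonNum`. -/
theorem countIs_of_split {α : Type*} {n k : ℕ} (hk : k ≤ n)
    (A : Finset ℕ → Finset ℕ → Set α)
    (h0 : ∀ S ⊆ Finset.Icc 1 n, (A ∅ S).encard = (((n - #S) ^ n : ℕ) : ℕ∞))
    (hsub : ∀ K S, A K S ⊆ A ∅ ∅)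
    (h1 : ∀ K S, ∀ s ∈ Finset.Icc 1 n, A (insert s K) S ∪ A K (insert s S) = A K S)
    (h2 : ∀ K S, ∀ s ∈ Finset.Icc 1 n, Disjoint (A (insert s K) S) (A K (insert s S))) :
    CountIs (A (Finset.Icc 1 k) ∅) (commonNum n k) := by
  have hfin : ∀ K S, CountIs (A K S) (A K S).ncard := fun K S =>
    ⟨_, (((Set.finite_of_encard_eq_coe (h0 ∅ (by simp))).subset (hsub K S)).cast_ncard_eq).symm,
      rfl⟩
  have h := eq_egfCount_of_recurrence (n := n) (Finset.Icc 1 n) (fun K S => ((A K S).ncard : ℚ))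
    (fun S hS => ?_) (fun K S s hs _ _ => ?_) (K := Finset.Icc 1 k) (S := ∅)
    (Finset.Icc_subset_Icc_right hk) (by simp) (by simp)
  · have h3 := hfin (Finset.Icc 1 k) ∅
    rwa [h, Finset.card_empty, pow_zero, one_mul, Nat.card_Icc, Nat.add_sub_cancel] at h3
  · have hle := Finset.card_le_card hS
    rw [Nat.card_Icc, Nat.add_sub_cancel] at hle
    rw [(hfin ∅ S).unique (CountIs.of_encard (h0 S hS)), Nat.cast_pow, Nat.cast_sub hle]
  · have h3 := (hfin (insert s K) S).union (hfin K (insert s S)) (h2 K S s hs)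
    rw [h1 K S s hs] at h3
    exact h3.unique (hfin K S)

/-- The leaf n+1 joins the prescribed leaves, giving (n+1 - (|S|+1))^n = (n - |S|)^n. For k > n the
vertex n+1 would have to be both a leaf and a nonleaf. -/
theorem countIs_setF (n k : ℕ) : CountIs (setF n k) (commonNum n k) := by
  rcases Nat.lt_or_ge n k with h | hk
  · rw [commonNum_eq_zero h]
    convert CountIs.empty
    rw [Set.eq_empty_iff_forall_notMem]
    rintro T ⟨-, h1, h2⟩
    have h3 := h2 (n + 1) (Finset.mem_Icc.2 ⟨by omega, by omega⟩)
    exact (T.isNonleaf_iff h1.1).1 h3 h1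
  set V := Finset.Icc 1 (n + 1) with hV
  have hcV : #V = n + 1 := by simp [hV]
  have hmV : ∀ s ∈ Finset.Icc 1 n, s ∈ V := fun s hs =>
    Finset.Icc_subset_Icc_right (Nat.le_succ n) hs
  have h := countIs_of_split hk (fun K S => {T : RTree | T.verts = V ∧ T.IsLeaf (n + 1) ∧
    (∀ i ∈ K, T.IsNonleaf i) ∧ ∀ i ∈ S, T.IsLeaf i}) ?_ ?_ ?_ ?_
  · convert h using 1
    ext T
    simp [setF, hV]
  · intro S hS
    have hn : n + 1 ∉ S := fun h => by
      have := Finset.mem_Icc.1 (hS h)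
      omega
    have h2 := encard_trees_leaves (V := V) (S := insert (n + 1) S)
      (Finset.insert_subset (by simp [hV]) fun s hs => hmV s (hS hs)) ⟨1, by simp [hV]⟩
    rw [hcV, Finset.card_insert_of_notMem hn, Nat.add_sub_add_right, Nat.add_sub_cancel] at h2
    rw [← h2]
    congr 1
    ext T
    simp
  · rintro K S T ⟨h1, h2, -⟩
    exact ⟨h1, h2, by simp, by simp⟩
  · intro K S s hs
    ext T
    simp only [Set.mem_union, Set.mem_ofPred_eq, Finset.forall_mem_insert]
    constructor
    · rintro (⟨h1, h2, ⟨-, h3⟩, h4⟩ | ⟨h1, h2, h3, -, h4⟩) <;> exact ⟨h1, h2, h3, h4⟩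
    · rintro ⟨h1, h2, h3, h4⟩
      by_cases hl : T.IsLeaf s
      · exact Or.inr ⟨h1, h2, h3, hl, h4⟩
      · exact Or.inl ⟨h1, h2, ⟨(T.isNonleaf_iff (h1 ▸ hmV s hs)).2 hl, h3⟩, h4⟩
  · intro K S s hs
    refine Set.disjoint_left.2 ?_
    rintro T ⟨h1, -, h2, -⟩ ⟨-, -, -, h3⟩
    exact (T.isNonleaf_iff (h1 ▸ hmV s hs)).1 (h2 s (Finset.mem_insert_self _ _))
      (h3 s (Finset.mem_insert_self _ _))

/-- A map missing `S` has n - |S| choices for each of its n values. For k > n the value n+1 is never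
attained. -/
theorem countIs_setFun (n k : ℕ) : CountIs (setFun n k) (commonNum n k) := by
  rcases Nat.lt_or_ge n k with h | hk
  · rw [commonNum_eq_zero h]
    convert CountIs.empty
    rw [Set.eq_empty_iff_forall_notMem]
    intro f hf
    obtain ⟨x, hx⟩ := hf (n + 1) (Finset.mem_Icc.2 ⟨by omega, by omega⟩)
    have := Finset.mem_Icc.1 (f x).2
    omega
  have h := countIs_of_split hk (fun K S => {f : Finset.Icc 1 n → Finset.Icc 1 n |
    (∀ i ∈ K, ∃ x, (f x : ℕ) = i) ∧ ∀ i ∈ S, ∀ x, (f x : ℕ) ≠ i}) ?_ ?_ ?_ ?_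
  · convert h using 1
    ext f
    simp only [setFun, Set.mem_ofPred_eq, Finset.notMem_empty, false_imp_iff, implies_true,
      and_true]
  · intro S hS
    have hset : {f : Finset.Icc 1 n → Finset.Icc 1 n |
        (∀ i ∈ (∅ : Finset ℕ), ∃ x, (f x : ℕ) = i) ∧ ∀ i ∈ S, ∀ x, (f x : ℕ) ≠ i} =
        (Fintype.piFinset fun _ : Finset.Icc 1 n =>
          ({y : Finset.Icc 1 n | (y : ℕ) ∉ S} : Finset (Finset.Icc 1 n)) :
          Set (Finset.Icc 1 n → Finset.Icc 1 n)) := by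
      ext f
      simp only [Set.mem_ofPred_eq, Finset.notMem_empty, false_imp_iff, implies_true, true_and,
        Finset.mem_coe, Fintype.mem_piFinset, Finset.mem_filter, Finset.mem_univ]
      exact ⟨fun h x hx => h _ hx x rfl, fun h i hi x e => h x (e ▸ hi)⟩
    have hcard : #({y : Finset.Icc 1 n | (y : ℕ) ∉ S} : Finset (Finset.Icc 1 n)) = n - #S := by
      have h1 : ({y : Finset.Icc 1 n | (y : ℕ) ∉ S} : Finset (Finset.Icc 1 n)).map
          (Function.Embedding.subtype _) = Finset.Icc 1 n \ S := by
        ext v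
        simp only [Finset.mem_map, Finset.mem_filter, Finset.mem_univ, true_and,
          Function.Embedding.subtype_apply, Subtype.exists, exists_and_left, exists_prop,
          exists_eq_right_right, Finset.mem_sdiff]
        tauto
      rw [← Finset.card_map, h1, Finset.card_sdiff_of_subset hS, Nat.card_Icc,
        Nat.add_sub_cancel]
    rw [hset, Set.encard_coe_eq_coe_finsetCard, Fintype.card_piFinset, Finset.prod_const, hcard,
      Finset.card_univ, Fintype.card_coe, Nat.card_Icc, Nat.add_sub_cancel]
  · rintro K S f -
    exact ⟨by simp, by simp⟩
  · intro K S s _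
    ext f
    simp only [Set.mem_union, Set.mem_ofPred_eq, Finset.forall_mem_insert]
    constructor
    · rintro (⟨⟨-, h3⟩, h4⟩ | ⟨h3, -, h4⟩) <;> exact ⟨h3, h4⟩
    · rintro ⟨h3, h4⟩
      by_cases hl : ∃ x, (f x : ℕ) = s
      · exact Or.inl ⟨⟨hl, h3⟩, h4⟩
      · exact Or.inr ⟨h3, fun x e => hl ⟨x, e⟩, h4⟩
  · intro K S s _
    refine Set.disjoint_left.2 ?_
    rintro f ⟨h1, -⟩ ⟨-, h2⟩
    obtain ⟨x, hx⟩ := h1 s (Finset.mem_insert_self _ _)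
    exact h2 s (Finset.mem_insert_self _ _) x hx

end LabelledTrees

open LabelledTrees in
theorem theorem3 (n k : ℕ) :
    Nonempty (setT n k ≃ setA n k) ∧
    Nonempty (setA n k ≃ setB n k) ∧
    (k ≤ n → Nonempty (setB n k ≃ setC n k) ∧ Nonempty (setC n k ≃ setF n k)) ∧
    Nonempty (setT n k ≃ setF n k) ∧
    Nonempty (setT n k ≃ setFun n k) ∧
    Nat.card (setT n k) = Nat.card (setFun n k) := by
  have hT := countIs_setT n k
  have hA := countIs_setA n k
  have hB := countIs_setB n k
  have hF := countIs_setF n k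
  have hE := countIs_setFun n k
  refine ⟨hT.nonempty_equiv hA, hA.nonempty_equiv hB, fun hk => ?_, hT.nonempty_equiv hF,
    hT.nonempty_equiv hE, Nat.card_congr (hT.nonempty_equiv hE).some⟩
  have hC := countIs_setC hk
  exact ⟨hB.nonempty_equiv hC, hC.nonempty_equiv hF⟩
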